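/- Let $F$ be a connected oriented surface of genus $g$ with $s\ge 1$ punctures, $2g+s-2>0$, and let $\tau\subset F$ be a trivalent fatgraph spine, dual to an ideal triangulation $\Delta$ of $F$. Let $\omega$, $\omega_\iota$ be orientations of the edges of $\tau$. Two orientations are equivalent if they differ by finitely many reflections; the reflection at a vertex reverses each edge once for each of its ends at that vertex. Write $[\omega]$ for the class of $\omega$. Choose a coordinate vector over the real Grassmann algebra: for each edge of $\Delta$ a $\lambda$-length (even, with positive body), for each side $e$ of each triangle a ratio $h_e$ (even, with positive body) with $h_eh_e'=1$ for the two triangles sharing $e$, and for each triangle a pair $\theta=(\theta_1,\theta_2)$ of odd elements. Every oriented closed curve on $F$ is freely homotopic to a closed path $\gamma$ without backtracking on $\tau$, unique up to its starting point. To $\gamma$ one assigns the composition, over its consecutive vertices with later factors on the left, $$\hat\rho(\gamma)=\prod_k Z_{\pm1}\circ\Psi_{\pm}\circ\Upsilon_{h_k'}^{\chi_k}\circ P_{h_k,h_k'}^{\theta_k,\pm}\in\widetilde{SL}(1|2).$$ Here $h_k,h_k'$ are the ratios at the sides by which $\gamma$ enters and leaves the $k$-th triangle, whose odd pair is $\theta_k$,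 and $\chi_k=\frac{ac}{bd}$ is the cross-ratio at the exit side $e=AC$ of the triangle $ABC$ (the quadrilateral $ABCD$ has sides $a=AB$, $b=BC$, $c=CD$, $d=DA$). Matrices are $(2|1)\times(2|1)$ supermatrices, with $D_{a,c}=\mathrm{diag}(a,ac,c)$, $Z_a=D_{a,a}$, $D_a=D_{a,a^{-1}}$, $J=\begin{pmatrix}0&0&1\\0&1&0\\-1&0&0\end{pmatrix}$, $U_\theta=\begin{pmatrix}1&0&0\\ \theta_2&1&0\\ 1+\frac{\theta_1\theta_2}2&-\theta_1&1\end{pmatrix}$ and $c_\theta=1+\frac{\theta_1\theta_2}6$; further $\Upsilon_h^\chi=JD_{\sqrt\chi}Z_h$, $P_{h,h'}^{\theta,+}=Z_{c_\theta}Z_{h'}^{-1}JU_\theta^{-1}Z_h$ for a left turn, $P_{h,h'}^{\theta,-}=(P_{h',h}^{\theta,+})^{-1}$ for a right turn. The sign factor is $Z_{-1}$ if $\gamma$ passes the exit edge in the direction of $\omega$ and $Z_1$ otherwise, and $\Psi_\pm$ is the involution $\Psi$ of $\widetilde{SL}(1|2)=\Psi\ltimes SL(1|2)_0$ if $\omega$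 and $\omega_\iota$ disagree on that edge and the identity otherwise. Let $\tilde\rho(\gamma)\in SL(2,\mathbb R)$ be the image of $\hat\rho(\gamma)$ under the projection $\Psi\mapsto\mathrm{Id}$, $\begin{pmatrix}a&*&b\\ *&f&*\\ c&*&d\end{pmatrix}\mapsto\frac1{\sqrt{f_\#}}\begin{pmatrix}a_\#&b_\#\\ c_\#&d_\#\end{pmatrix}$ ($x_\#$ is the body of $x$), and put $q([\gamma])=\operatorname{sign}\operatorname{Tr}\tilde\rho(\gamma)$. (1) For every such $\gamma$, in particular for every one homotopic to an oriented simple cycle, $$q([\gamma])=(-1)^{L_\gamma}(-1)^{N_\gamma}=(-1)^{R_\gamma}(-1)^{\overline N_\gamma},$$ where $L_\gamma$ (resp. $R_\gamma$) is the number of left (resp. right) turns of $\gamma$, and $N_\gamma$ (resp. $\overline N_\gamma$) is the number of passages of $\gamma$ along edges in the direction of (resp. against) $\omega$. These values depend only on $[\omega]$. (2) Let $\tau'$ be the result of the flip of $\tau$ along an edge $e$ with distinct end vertices. Draw $e$ vertically with $\omega$ pointing up, and with one upper left, upper right, lower left and lower right branch. After the flip the middle edge is horizontal; its left vertex carries the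 two left branches and its right vertex the two right ones. Let $\omega'$ be the orientation of $\tau'$ in which the middle edge points to the left, the edge of the upper right branch is reversed, and all other edges keep their orientation. Then $[\omega']$ depends only on $[\omega]$. Closed paths without backtracking on $\tau$ and on $\tau'$ correspond to each other under free homotopy on $F$, and for corresponding paths $\gamma,\gamma'$ one has $q_{\tau',[\omega']}([\gamma'])=q_{\tau,[\omega]}([\gamma])$, for any choice of coordinates and of $\omega_\iota$ on both sides. Moreover, $[\omega']$ is the only class of orientations of $\tau'$ with this property, even if the equality is required only for those $\gamma'$ that meet each vertex of $\tau'$ at most once. -/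

import Mathlib

/-!
Oriented trivalent fatgraphs, the coordinates and the representation with values in the
supergroup that they determine, and its projection to real two by two matrices.
-/

namespace SuperTeich

/-! ### The Grassmann algebra -/

section Grassmann

variable (V : Type*) [AddCommGroup V] [Module ℝ V]

/-- The real Grassmann algebra; the dimension of `V`, the number of its generators, may be
infinite. -/
abbrev Grassmann : Type _ := ExteriorAlgebra ℝ V

variable {V}

/-- The parity automorphism: `+1` on even elements, `-1` on odd elements. -/
noncomputable def parity : Grassmann V →ₐ[ℝ] Grassmann V := CliffordAlgebra.involute

/-- The body (constant term) of an element of the Grassmann algebra. -/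
noncomputable def body : Grassmann V →ₐ[ℝ] ℝ := ExteriorAlgebra.algebraMapInv

/-- Even (bosonic) elements. -/
def IsEven (x : Grassmann V) : Prop := parity x = x

/-- Odd (fermionic) elements. -/
def IsOdd (x : Grassmann V) : Prop := parity x = -x

theorem parity_parity (x : Grassmann V) : parity (parity x) = x :=
  CliffordAlgebra.involute_involute x

theorem mem_evenOdd_of_parity {x : Grassmann V} :
    (IsEven x → x ∈ CliffordAlgebra.evenOdd (0 : QuadraticForm ℝ V) 0) ∧
    (IsOdd x → x ∈ CliffordAlgebra.evenOdd (0 : QuadraticForm ℝ V) 1) := by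
  have hx : x ∈ (⊤ : Submodule ℝ (Grassmann V)) := Submodule.mem_top
  rw [← (CliffordAlgebra.evenOdd_isCompl (0 : QuadraticForm ℝ V)).sup_eq_top] at hx
  obtain ⟨u, hu, w, hw, rfl⟩ := Submodule.mem_sup.1 hx
  have h1 : parity u = u := CliffordAlgebra.involute_eq_of_mem_even hu
  have h2 : parity w = -w := CliffordAlgebra.involute_eq_of_mem_odd hw
  constructor
  · intro h
    have h' : parity (u + w) = u + w := h
    rw [map_add, h1, h2] at h'
    have h3 : (2 : ℝ) • w = 0 := by
      rw [two_smul]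
      have := add_left_cancel h'
      nth_rewrite 1 [← this]
      simp
    have h4 : w = 0 := (smul_eq_zero.1 h3).resolve_left (by norm_num)
    simpa [h4] using hu
  · intro h
    have h' : parity (u + w) = -(u + w) := h
    rw [map_add, h1, h2, neg_add] at h'
    have h3 : (2 : ℝ) • u = 0 := by
      rw [two_smul]
      have := add_right_cancel h'
      nth_rewrite 1 [this]
      simp
    have h4 : u = 0 := (smul_eq_zero.1 h3).resolve_left (by norm_num)
    simpa [h4] using hw

theorem iota_mul (v : V) (y : Grassmann V) :
    ExteriorAlgebra.ι ℝ v * y = parity y * ExteriorAlgebra.ι ℝ v := by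
  induction y using ExteriorAlgebra.induction with
  | algebraMap r => simp [Algebra.commutes]
  | ι w =>
    have h : parity (ExteriorAlgebra.ι ℝ w) = -ExteriorAlgebra.ι ℝ w :=
      CliffordAlgebra.involute_ι w
    rw [h, neg_mul, eq_neg_iff_add_eq_zero, ExteriorAlgebra.ι_add_mul_swap]
  | mul a b ha hb => rw [← mul_assoc, ha, mul_assoc, hb, map_mul, mul_assoc]
  | add a b ha hb => rw [mul_add, ha, hb, map_add, add_mul]

/-- Even elements are central. -/
theorem IsEven.comm {x : Grassmann V} (hx : IsEven x) (y : Grassmann V) : x * y = y * x := by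
  have h := mem_evenOdd_of_parity.1 hx
  clear hx
  induction x, h using CliffordAlgebra.even_induction with
  | algebraMap r => exact Algebra.commutes r y
  | add a b hx hy ihx ihy => rw [add_mul, mul_add, ihx, ihy]
  | ι_mul_ι_mul m₁ m₂ a hx ih =>
    have e : ∀ (v : V) (z : Grassmann V), CliffordAlgebra.ι (0 : QuadraticForm ℝ V) v * z =
      parity z * CliffordAlgebra.ι (0 : QuadraticForm ℝ V) v := iota_mul
    rw [mul_assoc, ih, ← mul_assoc, mul_assoc _ _ y, e m₂ y, ← mul_assoc, e m₁ (parity y),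
      parity_parity]
    simp only [mul_assoc]

/-- Odd elements anticommute. -/
theorem IsOdd.anticomm {x y : Grassmann V} (hx : IsOdd x) (hy : IsOdd y) :
    x * y = -(y * x) := by
  have h := mem_evenOdd_of_parity.2 hx
  clear hx
  have hy' : parity y = -y := hy
  have e : ∀ (v : V) (z : Grassmann V), CliffordAlgebra.ι (0 : QuadraticForm ℝ V) v * z =
      parity z * CliffordAlgebra.ι (0 : QuadraticForm ℝ V) v := iota_mul
  induction x, h using CliffordAlgebra.odd_induction with
  | ι v => rw [e v y, hy', neg_mul]
  | add a b hx hy ihx ihy => rw [add_mul, mul_add, ihx, ihy, neg_add]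
  | ι_mul_ι_mul m₁ m₂ a hx ih =>
    rw [mul_assoc, ih, mul_neg, ← mul_assoc, mul_assoc _ _ y, e m₂ y, ← mul_assoc,
      e m₁ (parity y), parity_parity]
    simp only [mul_assoc]

theorem IsOdd.mul_self {x : Grassmann V} (hx : IsOdd x) : x * x = 0 := by
  have h := hx.anticomm hx
  have h3 : (2 : ℝ) • (x * x) = 0 := by
    rw [two_smul]
    nth_rewrite 1 [h]
    simp
  exact (smul_eq_zero.1 h3).resolve_left (by norm_num)

theorem IsEven.isNilpotent_sub_body {x : Grassmann V} (hx : IsEven x) :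
    IsNilpotent (x - algebraMap ℝ _ (body x)) := by
  have h := mem_evenOdd_of_parity.1 hx
  clear hx
  induction x, h using CliffordAlgebra.even_induction with
  | algebraMap r =>
    have : body (algebraMap ℝ (Grassmann V) r) = r := by simp
    change IsNilpotent (algebraMap ℝ (Grassmann V) r - algebraMap ℝ (Grassmann V)
      (body (algebraMap ℝ (Grassmann V) r)))
    rw [this]; simp
  | add a b hx hy ihx ihy =>
    have ha : IsEven a := CliffordAlgebra.involute_eq_of_mem_even hx
    have hc : Commute (a - algebraMap ℝ _ (body a)) (b - algebraMap ℝ _ (body b)) := by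
      refine Commute.sub_left (ha.comm _) ?_
      exact Algebra.commutes _ _
    have := hc.isNilpotent_add ihx ihy
    rw [map_add, map_add]
    convert this using 1
    abel
  | ι_mul_ι_mul m₁ m₂ a hx ih =>
    have ha : IsEven a := CliffordAlgebra.involute_eq_of_mem_even hx
    set p : Grassmann V := CliffordAlgebra.ι (0 : QuadraticForm ℝ V) m₁
    set r : Grassmann V := CliffordAlgebra.ι (0 : QuadraticForm ℝ V) m₂
    have hp : IsOdd p := CliffordAlgebra.involute_ι m₁
    have hr : IsOdd r := CliffordAlgebra.involute_ι m₂
    have hb : body (p * r * a) = 0 := by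
      have : body p = 0 := by
        change ExteriorAlgebra.algebraMapInv (ExteriorAlgebra.ι ℝ m₁) = 0
        simp [ExteriorAlgebra.algebraMapInv]
      rw [map_mul, map_mul, this]; simp
    refine ⟨2, ?_⟩
    rw [hb, map_zero, sub_zero, pow_two]
    calc p * r * a * (p * r * a) = p * r * (a * (p * r)) * a := by simp only [mul_assoc]
      _ = p * (r * p) * r * a * a := by rw [ha.comm]; simp only [mul_assoc]
      _ = 0 := by
        rw [hr.anticomm hp, mul_neg, ← mul_assoc, hp.mul_self]; simp

end Grassmann

/-! ### Positive even elements -/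

section Positive

variable (V : Type*) [AddCommGroup V] [Module ℝ V]

/-- The group `ℝ₊` of even elements with positive body. (An even element with nonzero body is
invertible, so it is no restriction to work inside the group of units.) -/
noncomputable def RPlus : Subgroup (Grassmann V)ˣ where
  carrier := {u | IsEven (u : Grassmann V) ∧ 0 < body (u : Grassmann V)}
  one_mem' := by simp [IsEven]
  mul_mem' := by
    rintro a b ⟨ha, ha'⟩ ⟨hb, hb'⟩
    refine ⟨?_, ?_⟩
    · change parity _ = _
      have h1 : parity (a : Grassmann V) = a := ha
      have h2 : parity (b : Grassmann V) = b := hb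
      rw [Units.val_mul, map_mul, h1, h2]
    · rw [Units.val_mul, map_mul]; positivity
  inv_mem' := by
    rintro a ⟨ha, ha'⟩
    have h1 : parity (a : Grassmann V) = a := ha
    refine ⟨?_, ?_⟩
    · change parity _ = _
      refine (Units.inv_eq_of_mul_eq_one_right (u := a) ?_).symm
      nth_rewrite 1 [← h1]
      rw [← map_mul]; simp
    · have : body (a : Grassmann V) * body ((a⁻¹ : (Grassmann V)ˣ) : Grassmann V) = 1 := by
        rw [← map_mul]; simp
      exact pos_of_mul_pos_right (this ▸ one_pos) ha'.le

variable {V}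

/-- An even element with nonzero body is invertible. -/
theorem IsEven.isUnit {x : Grassmann V} (hx : IsEven x) (h0 : body x ≠ 0) : IsUnit x := by
  have h1 := hx.isNilpotent_sub_body
  have h2 : IsUnit (algebraMap ℝ (Grassmann V) (body x)) := (IsUnit.mk0 _ h0).map _
  have := IsNilpotent.isUnit_add_left_of_commute h1 h2 (Algebra.commutes _ _).symm
  simpa using this

theorem exists_sqrt (x : RPlus V) : ∃ s : RPlus V, s * s = x := by
  obtain ⟨x, hx, hp⟩ := x
  set X : Grassmann V := (x : Grassmann V) with hX
  have hcomm : IsMulCommutative (Algebra.adjoin ℝ {X}) :=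
    Algebra.isMulCommutative_adjoin ℝ (by
      intro a ha b hb
      rw [Set.mem_singleton_iff] at ha hb
      rw [ha, hb])
  have hXm : X ∈ Algebra.adjoin ℝ {X} := Algebra.self_mem_adjoin_singleton ℝ X
  set y : Algebra.adjoin ℝ {X} := ⟨X, hXm⟩
  set p : ℝ := √(body X) with hpdef
  have hp0 : 0 < p := Real.sqrt_pos.2 hp
  have hpp : p * p = body X := Real.mul_self_sqrt hp.le
  obtain ⟨n, hn⟩ := hx.isNilpotent_sub_body
  let A := Algebra.adjoin ℝ {X}
  let P : Polynomial A := Polynomial.X ^ 2 - Polynomial.C y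
  let c : A := algebraMap ℝ A p
  have e1 : Polynomial.aeval c P = c ^ 2 - y := by simp [P]
  have e2 : Polynomial.aeval c (Polynomial.derivative P) = algebraMap ℝ A (2 * p) := by
    simp [P, c, one_add_one_eq_two, map_ofNat]
  have hnil : IsNilpotent (Polynomial.aeval c P) := by
    rw [e1]
    have : IsNilpotent (y - c ^ 2) := by
      refine ⟨n, ?_⟩
      apply Subtype.ext
      rw [SubmonoidClass.coe_pow]
      change ((X - (algebraMap ℝ (Grassmann V) p) ^ 2) ^ n) = 0
      rw [← map_pow, pow_two, hpp]
      exact hn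
    simpa using this.neg
  have hunit : IsUnit (Polynomial.aeval c (Polynomial.derivative P)) := by
    rw [e2]
    exact (IsUnit.mk0 (2 * p) (by positivity)).map (algebraMap ℝ A)
  obtain ⟨r, ⟨hr1, hr2⟩, -⟩ :=
    Polynomial.existsUnique_nilpotent_sub_and_aeval_eq_zero hnil hunit
  have hr3 : r * r = y := by
    have : r ^ 2 - y = 0 := by simpa [P] using hr2
    rw [← pow_two]; exact sub_eq_zero.1 this
  have hrr : (r : Grassmann V) * r = X := congrArg Subtype.val hr3
  have hre : IsEven (r : Grassmann V) := by
    have hle : Algebra.adjoin ℝ {X} ≤ AlgHom.equalizer parity (AlgHom.id ℝ (Grassmann V)) := by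
      rw [Algebra.adjoin_le_iff, Set.singleton_subset_iff]
      exact hx
    exact hle r.2
  have hrb : body (r : Grassmann V) = p := by
    have h1 : IsNilpotent (body ((c - r : A) : Grassmann V)) := by
      obtain ⟨m, hm⟩ := hr1
      refine ⟨m, ?_⟩
      rw [← map_pow, ← SubmonoidClass.coe_pow, hm]
      simp
    have h2 := h1.eq_zero
    have h3 : ((c - r : A) : Grassmann V) = algebraMap ℝ (Grassmann V) p - r := rfl
    rw [h3, map_sub, AlgHom.commutes] at h2
    have : p - body (r : Grassmann V) = 0 := h2
    linarith
  have hru : IsUnit (r : Grassmann V) := hre.isUnit (by rw [hrb]; exact hp0.ne')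
  refine ⟨⟨hru.unit, ?_, ?_⟩, ?_⟩
  · simpa using hre
  · simpa [hrb] using hp0
  · apply Subtype.ext
    apply Units.ext
    simpa using hrr

/-- The square root with positive body of an element of `ℝ₊`. -/
noncomputable def rsqrt (x : RPlus V) : RPlus V := (exists_sqrt x).choose

theorem rsqrt_mul_self (x : RPlus V) : rsqrt x * rsqrt x = x := (exists_sqrt x).choose_spec

end Positive

/-! ### Supermatrices and the supergroup -/

section Supergroup

variable (V : Type*) [AddCommGroup V] [Module ℝ V]

/-- Three by three matrices over the Grassmann algebra. -/
abbrev Mat3 : Type _ := Matrix (Fin 3) (Fin 3) (Grassmann V)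

variable {V}

/-- The supermatrix with rows `(a, γ, b)`, `(α, f, δ)`, `(c, β, d)`, with `a b c d f` even and
`α β γ δ` odd. It is stored with a sign on `γ` and `β`, so that the ordinary product of matrices
over the Grassmann algebra becomes the multiplication of supermatrices, in which products of two
odd entries carry an extra minus sign (see `supermat_mul`). -/
def supermat (a γ b α f δ c β d : Grassmann V) : Mat3 V :=
  !![a, -γ, b; α, f, δ; c, -β, d]

theorem supermat_mul (a γ b α f δ c β d a' γ' b' α' f' δ' c' β' d' : Grassmann V) :
    supermat a γ b α f δ c β d * supermat a' γ' b' α' f' δ' c' β' d' =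
    supermat
      (a * a' - γ * α' + b * c') (a * γ' + γ * f' + b * β') (a * b' - γ * δ' + b * d')
      (α * a' + f * α' + δ * c') (-(α * γ') + f * f' - δ * β') (α * b' + f * δ' + δ * d')
      (c * a' - β * α' + d * c') (c * γ' + β * f' + d * β') (c * b' - β * δ' + d * d') := by
  ext i j
  fin_cases i <;> fin_cases j <;> simp [supermat, Matrix.mul_apply, Fin.sum_univ_three] <;> abel

theorem supermat_one : supermat (1 : Grassmann V) 0 0 0 1 0 0 0 1 = 1 := by
  ext i j
  fin_cases i <;> fin_cases j <;> simp [supermat]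

/-- The entries in the middle row or column, except the middle entry, are odd, and all others
are even. -/
def IsSuper (X : Mat3 V) : Prop :=
  ∀ i j, if (i = 1 ↔ j = 1) then IsEven (X i j) else IsOdd (X i j)

theorem isSuper_iff (X : Mat3 V) : IsSuper X ↔
    X.map parity = Matrix.diagonal ![1, -1, 1] * X * Matrix.diagonal ![1, -1, 1] := by
  rw [← Matrix.ext_iff]
  refine forall_congr' fun i => forall_congr' fun j => ?_
  fin_cases i <;> fin_cases j <;>
    simp [IsEven, IsOdd, Matrix.diagonal_mul, Matrix.mul_diagonal]

theorem diag_mul_self :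
    Matrix.diagonal ![1, -1, 1] * Matrix.diagonal ![1, -1, 1] = (1 : Mat3 V) := by
  rw [Matrix.diagonal_mul_diagonal, ← Matrix.diagonal_one]
  congr 1
  ext i
  fin_cases i <;> simp

variable (V) in
/-- The group of invertible even supermatrices. It contains `SL(1|2)₀`, the subgroup of those of
superdeterminant one whose middle entry has positive body. -/
noncomputable def SuperGL : Subgroup (Mat3 V)ˣ where
  carrier := {g | IsSuper (g : Mat3 V)}
  one_mem' := by
    change IsSuper _
    rw [isSuper_iff, Units.val_one, mul_one, diag_mul_self]
    exact Matrix.map_one _ (map_zero _) (map_one _)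
  mul_mem' := by
    intro g h hg hh
    change IsSuper _ at hg hh
    change IsSuper _
    rw [isSuper_iff] at *
    rw [Units.val_mul, Matrix.map_mul, hg, hh]
    have := diag_mul_self (V := V)
    set K : Mat3 V := Matrix.diagonal ![1, -1, 1]
    calc K * g * K * (K * h * K) = K * g * (K * K) * h * K := by simp only [mul_assoc]
      _ = K * (g * h) * K := by rw [this, mul_one]; simp only [mul_assoc]
  inv_mem' := by
    intro g hg
    change IsSuper _ at hg
    change IsSuper _
    rw [isSuper_iff] at *
    have hK := diag_mul_self (V := V)
    set K : Mat3 V := Matrix.diagonal ![1, -1, 1]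
    set X : Mat3 V := (g : Mat3 V)
    set Y : Mat3 V := ((g⁻¹ : (Mat3 V)ˣ) : Mat3 V)
    have hYX : Y * X = 1 := by simp [X, Y]
    have hXY : X * Y = 1 := by simp [X, Y]
    have h1 : Y.map parity * X.map parity = 1 := by
      rw [← Matrix.map_mul, hYX]
      exact Matrix.map_one _ (map_zero _) (map_one _)
    have h2 : X.map parity * (K * Y * K) = 1 := by
      rw [hg]
      calc K * X * K * (K * Y * K) = K * X * (K * K) * Y * K := by simp only [mul_assoc]
        _ = K * (X * Y) * K := by rw [hK, mul_one]; simp only [mul_assoc]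
        _ = 1 := by rw [hXY, mul_one, hK]
    exact left_inv_eq_right_inv h1 h2

/-- The infinitesimal involution of the superalgebra, up to the sign: `(a, γ, b; α, f, δ; c, β, d)`
is sent to `(d, -δ, -b; β, f, -γ; -c, α, a)`. It reverses products of even supermatrices. -/
def antiInvol (X : Mat3 V) : Mat3 V :=
  supermat (X 2 2) (-(X 1 2)) (-(X 0 2))
    (-(X 2 1)) (X 1 1) (X 0 1)
    (-(X 2 0)) (X 1 0) (X 0 0)

theorem antiInvol_supermat (a γ b α f δ c β d : Grassmann V) :
    antiInvol (supermat a γ b α f δ c β d) = supermat d (-δ) (-b) β f (-γ) (-c) α a := by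
  ext i j
  fin_cases i <;> fin_cases j <;> simp [antiInvol, supermat]

theorem antiInvol_antiInvol (X : Mat3 V) : antiInvol (antiInvol X) = X := by
  ext i j
  fin_cases i <;> fin_cases j <;> simp [antiInvol, supermat]

theorem antiInvol_one : antiInvol (1 : Mat3 V) = 1 := by
  ext i j
  fin_cases i <;> fin_cases j <;> simp [antiInvol, supermat]

theorem IsSuper.antiInvol {X : Mat3 V} (hX : IsSuper X) : IsSuper (antiInvol X) := by
  intro i j
  have h := hX (Fin.rev j) (Fin.rev i)
  fin_cases i <;> fin_cases j <;>
    simp_all [SuperTeich.antiInvol, supermat, IsEven, IsOdd, Fin.rev]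

theorem antiInvol_mul {X Y : Mat3 V} (hX : IsSuper X) (hY : IsSuper Y) :
    antiInvol (X * Y) = antiInvol Y * antiInvol X := by
  have key : ∀ i k j, X i k * Y k j =
      if (i = 1 ↔ k = 1) then Y k j * X i k
      else if (k = 1 ↔ j = 1) then Y k j * X i k else -(Y k j * X i k) := by
    intro i k j
    have h1 := hX i k
    have h2 := hY k j
    split_ifs at h1 h2 ⊢ with h3 h4
    · exact h1.comm _
    · exact h1.comm _
    · exact (h2.comm _).symm
    · exact h1.anticomm h2
  ext i j
  fin_cases i <;> fin_cases j <;>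
    simp [antiInvol, supermat, Matrix.mul_apply, Fin.sum_univ_three, key] <;> abel

variable (V) in
/-- The involution `Ψ` of the supergroup, `g ↦ antiInvol g⁻¹`. Its differential is the involution
of the Lie superalgebra given by `e₁⁺ ↔ e₂⁺`, `e₁⁻ ↔ -e₂⁻`, `h₁ ↔ -h₂`, `E ↦ E`, `F ↦ F`. -/
noncomputable def Psi : MulAut (SuperGL V) where
  toFun g := ⟨⟨antiInvol ((g⁻¹ : SuperGL V) : (Mat3 V)ˣ).val, antiInvol (g : (Mat3 V)ˣ).val,
      by rw [← antiInvol_mul g.2 (g⁻¹).2, ← Units.val_mul, ← Subgroup.coe_mul, mul_inv_cancel]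
         simp [antiInvol_one],
      by rw [← antiInvol_mul (g⁻¹).2 g.2, ← Units.val_mul, ← Subgroup.coe_mul, inv_mul_cancel]
         simp [antiInvol_one]⟩,
    IsSuper.antiInvol (g⁻¹).2⟩
  invFun g := ⟨⟨antiInvol ((g⁻¹ : SuperGL V) : (Mat3 V)ˣ).val, antiInvol (g : (Mat3 V)ˣ).val,
      by rw [← antiInvol_mul g.2 (g⁻¹).2, ← Units.val_mul, ← Subgroup.coe_mul, mul_inv_cancel]
         simp [antiInvol_one],
      by rw [← antiInvol_mul (g⁻¹).2 g.2, ← Units.val_mul, ← Subgroup.coe_mul, inv_mul_cancel]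
         simp [antiInvol_one]⟩,
    IsSuper.antiInvol (g⁻¹).2⟩
  left_inv g := by
    apply Subtype.ext
    apply Units.ext
    exact antiInvol_antiInvol _
  right_inv g := by
    apply Subtype.ext
    apply Units.ext
    exact antiInvol_antiInvol _
  map_mul' g h := by
    apply Subtype.ext
    apply Units.ext
    change antiInvol (((g * h)⁻¹ : SuperGL V) : (Mat3 V)ˣ).val = _
    rw [mul_inv_rev, Subgroup.coe_mul, Units.val_mul, antiInvol_mul (h⁻¹).2 (g⁻¹).2]
    rfl

variable (V) in
/-- The group generated by `Ψ` and the even supermatrices, their semidirect product. It contains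
the supergroup `Ψ ⋉ SL(1|2)₀`, in which all the elements below lie. -/
abbrev SuperGroup : Type _ :=
  SuperGL V ⋊[(Subgroup.zpowers (Psi V)).subtype] Subgroup.zpowers (Psi V)

/-- A supermatrix as an element of the group. -/
noncomputable def ofMat (g : SuperGL V) : SuperGroup V := SemidirectProduct.inl g

variable (V) in
/-- The involution `Ψ` as an element of the group. -/
noncomputable def psiElt : SuperGroup V :=
  SemidirectProduct.inr ⟨Psi V, Subgroup.mem_zpowers _⟩

/-- The canonical projection to real two by two matrices: the supermatrix with rows `(a, *, b)`,
`(*, f, *)`, `(c, *, d)` goes to the matrix of the bodies of `a b c d` divided by the square root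
of the body of `f`, and `Ψ` goes to the identity. -/
noncomputable def proj (g : SuperGroup V) : Matrix (Fin 2) (Fin 2) ℝ :=
  let M : Mat3 V := (g.left : (Mat3 V)ˣ).val
  (1 / √(body (M 1 1))) • !![body (M 0 0), body (M 0 2); body (M 2 0), body (M 2 2)]

/-- `D_{a,c}`, the diagonal supermatrix with entries `a, ac, c`. -/
noncomputable def matD (a c : (Grassmann V)ˣ) (ha : IsEven (a : Grassmann V))
    (hc : IsEven (c : Grassmann V)) : SuperGL V :=
  ⟨⟨supermat a 0 0 0 (a * c) 0 0 0 c,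
    supermat ↑a⁻¹ 0 0 0 (↑c⁻¹ * ↑a⁻¹) 0 0 0 ↑c⁻¹,
    by rw [supermat_mul, ← supermat_one]
       have : (a : Grassmann V) * c * (↑c⁻¹ * ↑a⁻¹) = 1 := by
         rw [mul_assoc, ← mul_assoc (c : Grassmann V)]; simp
       simp [this],
    by rw [supermat_mul, ← supermat_one]
       have : (↑c⁻¹ * ↑a⁻¹ : Grassmann V) * (↑a * ↑c) = 1 := by
         rw [mul_assoc, ← mul_assoc _ (a : Grassmann V)]; simp
       simp [this]⟩, by
    have h1 : parity (a : Grassmann V) = a := ha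
    have h2 : parity (c : Grassmann V) = c := hc
    intro i j
    fin_cases i <;> fin_cases j <;> simp [supermat, IsEven, IsOdd, h1, h2]⟩

/-- `Z_a = D_{a,a}`. -/
noncomputable def matZ (a : RPlus V) : SuperGL V := matD a a a.2.1 a.2.1

/-- `D_a = D_{a,a⁻¹}`. -/
noncomputable def matD' (a : RPlus V) : SuperGL V :=
  matD a (a⁻¹ : RPlus V) a.2.1 (a⁻¹ : RPlus V).2.1

variable (V) in
/-- The sign change `Z_{-1}`. -/
noncomputable def matZneg : SuperGL V :=
  matD (-1) (-1) (by simp [IsEven]) (by simp [IsEven])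

variable (V) in
/-- `J`, with rows `(0, 0, 1)`, `(0, 1, 0)`, `(-1, 0, 0)`. -/
noncomputable def matJ : SuperGL V :=
  ⟨⟨supermat 0 0 1 0 1 0 (-1) 0 0, supermat 0 0 (-1) 0 1 0 1 0 0,
    by rw [supermat_mul, ← supermat_one]; simp,
    by rw [supermat_mul, ← supermat_one]; simp⟩, by
    intro i j
    fin_cases i <;> fin_cases j <;> simp [supermat, IsEven, IsOdd]⟩

/-- The lower triangular supermatrix `U` with rows `(1, 0, 0)`, `(θ₂, 1, 0)`,
`(1 + θ₁θ₂/2, -θ₁, 1)`. -/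
noncomputable def matU (θ₁ θ₂ : Grassmann V) (h₁ : IsOdd θ₁) (h₂ : IsOdd θ₂) : SuperGL V :=
  ⟨⟨supermat 1 0 0 θ₂ 1 0 (1 + (1 / 2 : ℝ) • (θ₁ * θ₂)) (-θ₁) 1,
    supermat 1 0 0 (-θ₂) 1 0 ((1 / 2 : ℝ) • (θ₁ * θ₂) - 1) θ₁ 1,
    by rw [supermat_mul, ← supermat_one]
       have : (1 + (2⁻¹ : ℝ) • (θ₁ * θ₂)) - θ₁ * θ₂ + ((2⁻¹ : ℝ) • (θ₁ * θ₂) - 1) = 0 := by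
         module
       simp [this],
    by rw [supermat_mul, ← supermat_one]
       have : ((2⁻¹ : ℝ) • (θ₁ * θ₂) - 1) - θ₁ * θ₂ + (1 + (2⁻¹ : ℝ) • (θ₁ * θ₂)) = 0 := by
         module
       simp [this]⟩, by
    have h1 : parity θ₁ = -θ₁ := h₁
    have h2 : parity θ₂ = -θ₂ := h₂
    intro i j
    fin_cases i <;> fin_cases j <;> simp [supermat, IsEven, IsOdd, h1, h2]⟩

/-- The constant `c_θ = 1 + θ₁θ₂/6`. -/
noncomputable def cTheta (θ₁ θ₂ : Grassmann V) (h₁ : IsOdd θ₁) (h₂ : IsOdd θ₂) : RPlus V :=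
  have hsq : (θ₁ * θ₂) * (θ₁ * θ₂) = 0 := by
    rw [mul_assoc, ← mul_assoc θ₂, h₂.anticomm h₁, neg_mul, mul_assoc, h₂.mul_self]; simp
  ⟨⟨1 + (1 / 6 : ℝ) • (θ₁ * θ₂), 1 - (1 / 6 : ℝ) • (θ₁ * θ₂),
    by simp [mul_sub, add_mul, hsq], by simp [mul_add, sub_mul, hsq]⟩, by
    have h1 : parity θ₁ = -θ₁ := h₁
    have h2 : parity θ₂ = -θ₂ := h₂
    refine ⟨by simp [IsEven, h1, h2], ?_⟩
    have : body (θ₁ * θ₂) * body (θ₁ * θ₂) = 0 := by rw [← map_mul, hsq, map_zero]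
    have h3 : body (θ₁ * θ₂) = 0 := mul_self_eq_zero.1 this
    simp only [map_add, map_one, map_smul, h3]
    simp⟩

/-- The prime transformation `P_{h,h'}^θ = Z_{c_θ} Z_{h'}⁻¹ P' Z_h`, where `P' = J U⁻¹`. -/
noncomputable def prime (h h' : RPlus V) (θ₁ θ₂ : Grassmann V) (h₁ : IsOdd θ₁) (h₂ : IsOdd θ₂) :
    SuperGL V :=
  matZ (cTheta θ₁ θ₂ h₁ h₂) * (matZ h')⁻¹ * (matJ V * (matU θ₁ θ₂ h₁ h₂)⁻¹) * matZ h

/-- The upside-down transformation `Υ_h^χ = J D_{√χ} Z_h`. -/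
noncomputable def upsideDown (h χ : RPlus V) : SuperGL V :=
  matJ V * matD' (rsqrt χ) * matZ h

end Supergroup

/-! ### Oriented trivalent fatgraphs -/

/-- A trivalent fatgraph with set of half-edges `D`: the permutation `σ` sends a half-edge to the
next one in the counterclockwise order at its vertex, and the involution `ι` exchanges the two
halves of an edge. So the vertices are the cycles of `σ`, all of length three, and the edges are
the cycles of `ι`. Thickening gives the surface with punctures of which the graph is a spine and
whose punctures are the cycles of `σ ∘ ι`. A half-edge at a vertex is also a pair consisting of
a triangle of the dual triangulation and a side of that triangle. -/
structure Fatgraph (D : Type*) where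
  /-- The counterclockwise rotation about the vertices. -/
  σ : Equiv.Perm D
  /-- The exchange of the two halves of an edge. -/
  ι : Equiv.Perm D
  σ_ne : ∀ x, σ x ≠ x
  σ_cube : ∀ x, σ (σ (σ x)) = x
  ι_ne : ∀ x, ι x ≠ x
  ι_ι : ∀ x, ι (ι x) = x

namespace Fatgraph

variable {D : Type*} [DecidableEq D] (τ : Fatgraph D)

/-- The half-edges `x` and `y` are at the same vertex. -/
abbrev SameVertex (x y : D) : Prop := y = x ∨ y = τ.σ x ∨ y = τ.σ (τ.σ x)

/-- Any two half-edges can be joined along the graph. -/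
def Connected : Prop :=
  Nonempty D ∧ ∀ x y : D, Relation.ReflTransGen (fun u v => v = τ.σ u ∨ v = τ.ι u) x y

/-- An orientation of the edges: `out x` holds if the edge of `x` is oriented away from the vertex
of the half-edge `x`. -/
structure Orientation where
  /-- Whether the edge points away from the vertex of the half-edge. -/
  out : D → Bool
  out_ι : ∀ x, out (τ.ι x) = !out x

variable {τ}

/-- The reflection of an orientation at the vertex of `v`: every edge with an end at this vertex is
reversed, once for each of its ends there (so a loop at the vertex is reversed twice). -/
def Orientation.reflect (ω : τ.Orientation) (v : D) : τ.Orientation where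
  out x := ω.out x ^^ decide (τ.SameVertex v x) ^^ decide (τ.SameVertex v (τ.ι x))
  out_ι x := by
    rw [τ.ι_ι, ω.out_ι]
    cases ω.out x <;> cases decide (τ.SameVertex v x) <;>
      cases decide (τ.SameVertex v (τ.ι x)) <;> rfl

/-- Two orientations are equivalent if a finite sequence of reflections takes one to the other. -/
def Orientation.Equivalent (ω ω' : τ.Orientation) : Prop :=
  Relation.ReflTransGen (fun a b => ∃ v, b = a.reflect v) ω ω'

/-- The two directions that a path can take at a vertex. -/
inductive Turn
  | left
  | right
  deriving DecidableEq

variable (τ)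

/-- The half-edge along which a path that has come in along the half-edge `x` leaves the vertex
of `x`. Seen from `x`, the next half-edge in the counterclockwise order is on the right. -/
def exit (x : D) : Turn → D
  | .left => τ.σ.symm x
  | .right => τ.σ x

/-- The half-edges along which a path leaves the vertices that it meets, in order: the path comes
in along `x` and makes the given turns. -/
def exits (τ : Fatgraph D) : D → List Turn → List D
  | _, [] => []
  | x, t :: w => τ.exit x t :: τ.exits (τ.ι (τ.exit x t)) w

/-- The half-edge along which the path comes in after it has made the given turns. -/
def endpoint (τ : Fatgraph D) : D → List Turn → D
  | x, [] => x
  | x, t :: w => τ.endpoint (τ.ι (τ.exit x t)) w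

/-- An oriented closed path without backtracking on the fatgraph: it starts at a vertex, into which
it comes along the half-edge `start`, and having made the listed turns it comes again into this
vertex along `start`. Each free homotopy class of oriented closed curves on the surface contains
such a path, and only one up to the choice of the start. -/
structure ClosedPath where
  /-- The half-edge along which the path first comes in. -/
  start : D
  /-- The turns at the consecutive vertices. -/
  turns : List Turn
  closed : τ.endpoint start turns = start

variable {τ}

namespace ClosedPath

/-- The half-edges along which the path leaves the consecutive vertices; each stands for a passage
along its edge, away from the vertex of the half-edge. -/
def edges (γ : τ.ClosedPath) : List D := τ.exits γ.start γ.turns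

/-- The number of left turns. -/
def numLeft (γ : τ.ClosedPath) : ℕ := γ.turns.count .left

/-- The number of right turns. -/
def numRight (γ : τ.ClosedPath) : ℕ := γ.turns.count .right

/-- The number of passages along edges in the direction of the orientation. -/
def numSame (γ : τ.ClosedPath) (ω : τ.Orientation) : ℕ := γ.edges.countP fun y => ω.out y

/-- The number of passages along edges against the direction of the orientation. -/
def numOpposite (γ : τ.ClosedPath) (ω : τ.Orientation) : ℕ := γ.edges.countP fun y => !ω.out y

/-- The path meets each vertex at most once. -/
def IsEmbedded (γ : τ.ClosedPath) : Prop := γ.edges.Pairwise fun x y => ¬ τ.SameVertex x y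

end ClosedPath

/-! ### Coordinates and the representation -/

section Coordinates

variable (V : Type*) [AddCommGroup V] [Module ℝ V]

variable (τ) in
/-- Coordinate vectors on the triangulation dual to the fatgraph: a `λ`-length for each edge, a
ratio for each side of each triangle, and two odd coordinates for each triangle. -/
structure Coordinates where
  /-- The `λ`-lengths. -/
  lam : D → RPlus V
  /-- The ratios. -/
  ratio : D → RPlus V
  /-- The first odd coordinate. -/
  θ₁ : D → Grassmann V
  /-- The second odd coordinate. -/
  θ₂ : D → Grassmann V
  lam_ι : ∀ x, lam (τ.ι x) = lam x
  ratio_ι : ∀ x, ratio (τ.ι x) * ratio x = 1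
  odd₁ : ∀ x, IsOdd (θ₁ x)
  odd₂ : ∀ x, IsOdd (θ₂ x)
  θ₁_σ : ∀ x, θ₁ (τ.σ x) = θ₁ x
  θ₂_σ : ∀ x, θ₂ (τ.σ x) = θ₂ x

variable {V}

/-- The cross-ratio `ac/(bd)` of the quadrilateral `ABCD` around the side `e = AC` of the triangle
`ABC`, where `a, b, c, d` are the `λ`-lengths of `AB, BC, CD, DA`. -/
noncomputable def Coordinates.crossRatio (C : τ.Coordinates V) (e : D) : RPlus V :=
  C.lam (τ.σ.symm e) * C.lam (τ.σ.symm (τ.ι e)) * (C.lam (τ.σ e) * C.lam (τ.σ (τ.ι e)))⁻¹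

/-- The prime transformation for a turn in the triangle of `x`, from the side `x`: to the left it
is `P_{h,h'}^θ`, and to the right it is the inverse of `P_{h',h}^θ`, where `h` is the ratio at the
side `x` and `h'` that at the side by which the path leaves. -/
noncomputable def Coordinates.turnElt (C : τ.Coordinates V) (x : D) : Turn → SuperGL V
  | .left => prime (C.ratio x) (C.ratio (τ.exit x .left)) (C.θ₁ x) (C.θ₂ x) (C.odd₁ x) (C.odd₂ x)
  | .right =>
    (prime (C.ratio (τ.exit x .right)) (C.ratio x) (C.θ₁ x) (C.θ₂ x) (C.odd₁ x) (C.odd₂ x))⁻¹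

/-- The factor `Z_{±1} Ψ_± Υ_{h'}^χ P_{h,h'}^{θ,±}` for a turn followed by the passage along the
next edge. The sign is `-1` if the passage is in the direction of `ω`, and the involution is present
if `ω` and `ω'` orient the edge differently. -/
noncomputable def Coordinates.stepElt (C : τ.Coordinates V) (ω ω' : τ.Orientation) (x : D)
    (t : Turn) : SuperGroup V :=
  let y := τ.exit x t
  (if ω.out y then ofMat (matZneg V) else 1) *
  (if ω.out y = ω'.out y then 1 else psiElt V) *
  ofMat (upsideDown (C.ratio y) (C.crossRatio y)) *
  ofMat (C.turnElt x t)

/-- The composition of the factors along a path, with the later factors on the left. -/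
noncomputable def Coordinates.pathElt (C : τ.Coordinates V) (ω ω' : τ.Orientation) :
    D → List Turn → SuperGroup V
  | _, [] => 1
  | x, t :: w => C.pathElt ω ω' (τ.ι (τ.exit x t)) w * C.stepElt ω ω' x t

/-- The element of the supergroup that the coordinates and the two oriented fatgraphs assign to
a closed path. -/
noncomputable def Coordinates.rhoHat (C : τ.Coordinates V) (ω ω' : τ.Orientation)
    (γ : τ.ClosedPath) : SuperGroup V :=
  C.pathElt ω ω' γ.start γ.turns

/-- Its projection to real two by two matrices. -/
noncomputable def Coordinates.rhoTilde (C : τ.Coordinates V) (ω ω' : τ.Orientation)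
    (γ : τ.ClosedPath) : Matrix (Fin 2) (Fin 2) ℝ :=
  proj (C.rhoHat ω ω' γ)

/-- The value of the quadratic form on a cycle, written multiplicatively: the sign of the trace
of the lift. -/
noncomputable def Coordinates.quadForm (C : τ.Coordinates V) (ω ω' : τ.Orientation)
    (γ : τ.ClosedPath) : ℤ :=
  SignType.sign (C.rhoTilde ω ω' γ).trace

end Coordinates

/-! ### Flips -/

/-- The permutation of the four branches at the ends of the edge of `e` by a counterclockwise
quarter turn. If the edge is drawn vertically with the half-edge `e` at the upper vertex, it takes
the upper right branch to the upper left one, this one to the lower left one, this one to the lower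
right one, and this one to the upper right one; all other half-edges are fixed. -/
def quarterTurn (τ : Fatgraph D) (e : D) : Equiv.Perm D :=
  [τ.σ e, τ.σ (τ.σ e), τ.σ (τ.ι e), τ.σ (τ.σ (τ.ι e))].formPerm

/-- The flip along the edge of `e`, which is meant to have different ends. If the edge is drawn
vertically with `e` at the upper vertex, after the flip it is horizontal with `e` at the left
vertex, to which the two left branches are now attached, while the two right branches are attached
to the right vertex. -/
def flip (τ : Fatgraph D) (e : D) : Fatgraph D where
  σ := τ.quarterTurn e * τ.σ * (τ.quarterTurn e)⁻¹
  ι := τ.ι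
  σ_ne x h := by
    have h' : τ.quarterTurn e (τ.σ ((τ.quarterTurn e)⁻¹ x)) = x := h
    refine τ.σ_ne ((τ.quarterTurn e)⁻¹ x) ?_
    nth_rewrite 2 [← h']
    simp
  σ_cube x := by simp [τ.σ_cube]
  ι_ne := τ.ι_ne
  ι_ι := τ.ι_ι

/-- The half of the edge of `e` at the vertex to which the edge points. -/
def Orientation.head (ω : τ.Orientation) (e : D) : D := if ω.out e then τ.ι e else e

/-- The evolution of an orientation under the flip along the edge of `e`. Draw the edge vertically
and pointing up; after the flip it points to the left, the edge of the upper right branch is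
reversed, and the other edges keep their orientation. -/
def Orientation.flip (ω : τ.Orientation) (e : D) : (τ.flip e).Orientation where
  out x :=
    if x = τ.σ (ω.head e) ∨ x = τ.ι (τ.σ (ω.head e)) then !ω.out x else ω.out x
  out_ι x := by
    change (if τ.ι x = τ.σ (ω.head e) ∨ τ.ι x = τ.ι (τ.σ (ω.head e)) then !ω.out (τ.ι x)
      else ω.out (τ.ι x)) = _
    have h1 : τ.ι x = τ.σ (ω.head e) ↔ x = τ.ι (τ.σ (ω.head e)) :=
      ⟨fun h => by rw [← h, τ.ι_ι], fun h => by rw [h, τ.ι_ι]⟩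
    have h2 : τ.ι x = τ.ι (τ.σ (ω.head e)) ↔ x = τ.σ (ω.head e) := τ.ι.injective.eq_iff
    simp only [h1, h2, ω.out_ι, or_comm (a := x = τ.ι (τ.σ (ω.head e)))]
    split_ifs <;> rfl

/-- A closed path on a fatgraph and one on its flip are freely homotopic on the surface: when the
flipped edge is collapsed in both of them, they become the same closed path on the graph with one
four-valent vertex. -/
def FlipHomotopic (e : D) (γ : τ.ClosedPath) (γ' : (τ.flip e).ClosedPath) : Prop :=
  (γ.edges.filter fun x => x ≠ e ∧ x ≠ τ.ι e) ~r (γ'.edges.filter fun x => x ≠ e ∧ x ≠ τ.ι e)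

end Fatgraph

end SuperTeich

/-!
On bodies the supermatrices are block matrices, with `r • M`, `M ∈ SL(2, ℝ)`, in the corners and
`r²` in the middle (`LiesOver`); `Ψ` only inverts the scalar `r`, so the projection is
multiplicative. A step projects to a triangular matrix with positive diagonal and nonpositive
off-diagonal entries, up to one sign for a left turn and one for a passage in the direction of the
orientation. Matrices of that kind form a monoid and have positive trace, so the sign of the trace
is the product of these signs (`Coordinates.quadForm_eq`).

The rest is a computation modulo 2. A closed path is a closed walk from exit to exit, in which
every step has a weight, and the weight of a closed walk does not change when the weights of the
steps are modified by a coboundary (`Walk.gauge`). A reflection is such a modification. For the flip,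
both fatgraphs are compared on the graph in which the edge is collapsed: they have the same steps
there, with weights that differ by a coboundary (`collapseRel_flip`). Hence closed paths correspond
and have the same weight.

For uniqueness, let two orientations of a connected fatgraph have the same weights on embedded
closed paths. Their difference `δ` sums to zero along these, hence along all closed walks, as a
shortest counterexample would be embedded (`vertexWalk_closed_weight`). So `δ` is the coboundary of a
function of the vertices (`exists_potential`), and reflecting at the vertices where this function
does not vanish takes one orientation to the other. That the class of the flipped orientation
depends only on the class of the orientation follows from this uniqueness.
-/

namespace SuperTeich

/-! ### The body of the representation -/

section Body

variable {V : Type*} [AddCommGroup V] [Module ℝ V]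

theorem body_parity (x : Grassmann V) : body (parity x) = body x := by
  induction x using ExteriorAlgebra.induction with
  | algebraMap r => simp
  | ι v =>
    have h : parity (ExteriorAlgebra.ι ℝ v) = -ExteriorAlgebra.ι ℝ v :=
      CliffordAlgebra.involute_ι v
    have h0 : body (ExteriorAlgebra.ι ℝ v) = 0 := by
      simp [body, ExteriorAlgebra.algebraMapInv]
    rw [h, map_neg, h0, neg_zero]
  | mul a b ha hb => rw [map_mul, map_mul, map_mul, ha, hb]
  | add a b ha hb => rw [map_add, map_add, map_add, ha, hb]

theorem IsOdd.body_eq_zero {x : Grassmann V} (hx : IsOdd x) : body x = 0 := by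
  have h := body_parity x
  rw [hx, map_neg] at h
  linarith

/-- The real three by three matrix that has `r • M` in its corners, `r²` in the middle and zeros
elsewhere. -/
def blockMat (r : ℝ) (M : Matrix (Fin 2) (Fin 2) ℝ) : Matrix (Fin 3) (Fin 3) ℝ :=
  !![r * M 0 0, 0, r * M 0 1; 0, r ^ 2, 0; r * M 1 0, 0, r * M 1 1]

theorem blockMat_mul (r s : ℝ) (M N : Matrix (Fin 2) (Fin 2) ℝ) :
    blockMat r M * blockMat s N = blockMat (r * s) (M * N) := by
  ext i j
  fin_cases i <;> fin_cases j <;>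
    simp [blockMat, Matrix.mul_apply, Fin.sum_univ_three] <;> ring

/-- The supermatrix `g` lies over `M ∈ SL(2, ℝ)`: its body is `M` up to a positive scalar `r`, and
its middle entry has body `r²`, as superdeterminant one demands. -/
def LiesOver (g : SuperGL V) (M : Matrix (Fin 2) (Fin 2) ℝ) : Prop :=
  M.det = 1 ∧ ∃ r : ℝ, 0 < r ∧ (g : (Mat3 V)ˣ).val.map body = blockMat r M

theorem LiesOver.mul {g h : SuperGL V} {M N : Matrix (Fin 2) (Fin 2) ℝ} (hg : LiesOver g M)
    (hh : LiesOver h N) : LiesOver (g * h) (M * N) := by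
  obtain ⟨dM, r, hr, eg⟩ := hg
  obtain ⟨dN, s, hs, eh⟩ := hh
  refine ⟨by rw [Matrix.det_mul, dM, dN, one_mul], r * s, mul_pos hr hs, ?_⟩
  rw [Subgroup.coe_mul, Units.val_mul, Matrix.map_mul, eg, eh, blockMat_mul]

theorem LiesOver.of_eq {g : SuperGL V} {M N : Matrix (Fin 2) (Fin 2) ℝ} (hg : LiesOver g M)
    (h : M = N) : LiesOver g N := h ▸ hg

theorem LiesOver.one : LiesOver (1 : SuperGL V) 1 := by
  refine ⟨Matrix.det_one, 1, one_pos, ?_⟩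
  ext i j
  fin_cases i <;> fin_cases j <;> simp [blockMat]

theorem LiesOver.inv {g : SuperGL V} {M : Matrix (Fin 2) (Fin 2) ℝ} (hg : LiesOver g M) :
    LiesOver g⁻¹ M.adjugate := by
  obtain ⟨dM, r, hr, eg⟩ := hg
  refine ⟨by rw [Matrix.det_adjugate, dM, one_pow], r⁻¹, inv_pos.2 hr, ?_⟩
  have h1 : ((g⁻¹ : SuperGL V) : (Mat3 V)ˣ).val.map body * (g : (Mat3 V)ˣ).val.map body = 1 := by
    rw [← Matrix.map_mul, Subgroup.coe_inv, Units.inv_mul]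
    exact Matrix.map_one _ (map_zero _) (map_one _)
  refine left_inv_eq_right_inv h1 ?_
  rw [eg, blockMat_mul, Matrix.mul_adjugate, dM, mul_inv_cancel₀ hr.ne']
  ext i j
  fin_cases i <;> fin_cases j <;> simp [blockMat]

/-- On bodies `Ψ` only changes the scalar, to its inverse: for two by two matrices, reversing and
inverting is division by the determinant. -/
theorem LiesOver.psi {g : SuperGL V} {M : Matrix (Fin 2) (Fin 2) ℝ} (hg : LiesOver g M) :
    LiesOver (Psi V g) M := by
  obtain ⟨-, r, hr, eg⟩ := hg.inv
  refine ⟨hg.1, r, hr, ?_⟩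
  change (antiInvol ((g⁻¹ : SuperGL V) : (Mat3 V)ˣ).val).map body = _
  generalize ((g⁻¹ : SuperGL V) : (Mat3 V)ˣ).val = X at eg
  rw [← Matrix.ext_iff] at eg
  simp only [Matrix.map_apply] at eg
  ext i j
  fin_cases i <;> fin_cases j <;>
    simp [antiInvol, supermat, eg, blockMat, Matrix.adjugate_fin_two]

theorem psi_psi (g : SuperGL V) : Psi V (Psi V g) = g := (Psi V).left_inv g

theorem LiesOver.zpowers_psi {φ : MulAut (SuperGL V)} (hφ : φ ∈ Subgroup.zpowers (Psi V))
    {g : SuperGL V} {M : Matrix (Fin 2) (Fin 2) ℝ} (hg : LiesOver g M) : LiesOver (φ g) M := by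
  let S : Subgroup (MulAut (SuperGL V)) :=
    { carrier := {φ | ∀ g M, LiesOver (φ g) M ↔ LiesOver g M}
      one_mem' := fun _ _ => Iff.rfl
      mul_mem' := fun {a b} ha hb g M => (ha (b g) M).trans (hb g M)
      inv_mem' := fun {a} ha g M => by
        have := ha (a⁻¹ g) M
        rw [MulAut.apply_inv_self] at this
        exact this.symm }
  have h : Psi V ∈ S := fun g M =>
    ⟨fun h => by simpa only [psi_psi] using h.psi, fun h => h.psi⟩
  exact ((Subgroup.zpowers_le.2 h hφ) g M).2 hg

theorem LiesOver.left_mul {G H : SuperGroup V} {M N : Matrix (Fin 2) (Fin 2) ℝ}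
    (hG : LiesOver G.left M) (hH : LiesOver H.left N) : LiesOver (G * H).left (M * N) :=
  hG.mul (hH.zpowers_psi G.right.2)

theorem LiesOver.proj_eq {G : SuperGroup V} {M : Matrix (Fin 2) (Fin 2) ℝ}
    (hG : LiesOver G.left M) : proj G = M := by
  obtain ⟨-, r, hr, e⟩ := hG
  have e' : ∀ i j, body (((G.left : SuperGL V) : (Mat3 V)ˣ).val i j) = blockMat r M i j :=
    fun i j => by rw [← e]; rfl
  ext i j
  fin_cases i <;> fin_cases j <;>
    simp [proj, e', blockMat, Real.sqrt_sq hr.le, inv_mul_cancel_left₀ hr.ne']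

theorem liesOver_matZ (a : RPlus V) : LiesOver (matZ a) 1 := by
  refine ⟨Matrix.det_one, body (a : (Grassmann V)ˣ).val, a.2.2, ?_⟩
  ext i j
  fin_cases i <;> fin_cases j <;> simp [matZ, matD, supermat, blockMat, pow_two]

theorem liesOver_matD' (a : RPlus V) :
    LiesOver (matD' a)
      !![body (a : (Grassmann V)ˣ).val, 0; 0, (body (a : (Grassmann V)ˣ).val)⁻¹] := by
  have h : body (a : (Grassmann V)ˣ).val ≠ 0 := ne_of_gt a.2.2
  refine ⟨by simp [Matrix.det_fin_two_of, h], 1, one_pos, ?_⟩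
  ext i j
  fin_cases i <;> fin_cases j <;>
    simp [matD', matD, supermat, blockMat]

theorem liesOver_matZneg : LiesOver (matZneg V) (-1) := by
  refine ⟨by simp [Matrix.det_fin_two], 1, one_pos, ?_⟩
  ext i j
  fin_cases i <;> fin_cases j <;> simp [matZneg, matD, supermat, blockMat]

theorem liesOver_matJ : LiesOver (matJ V) !![0, 1; -1, 0] := by
  refine ⟨by simp [Matrix.det_fin_two_of], 1, one_pos, ?_⟩
  ext i j
  fin_cases i <;> fin_cases j <;> simp [matJ, supermat, blockMat]

theorem liesOver_matU (θ₁ θ₂ : Grassmann V) (h₁ : IsOdd θ₁) (h₂ : IsOdd θ₂) :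
    LiesOver (matU θ₁ θ₂ h₁ h₂) !![1, 0; 1, 1] := by
  refine ⟨by simp [Matrix.det_fin_two_of], 1, one_pos, ?_⟩
  ext i j
  fin_cases i <;> fin_cases j <;>
    simp [matU, supermat, blockMat, h₁.body_eq_zero, h₂.body_eq_zero]

theorem liesOver_prime (h h' : RPlus V) (θ₁ θ₂ : Grassmann V) (h₁ : IsOdd θ₁) (h₂ : IsOdd θ₂) :
    LiesOver (prime h h' θ₁ θ₂ h₁ h₂) !![-1, 1; -1, 0] := by
  have := (((liesOver_matZ (cTheta θ₁ θ₂ h₁ h₂)).mul (liesOver_matZ h').inv).mul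
    ((liesOver_matJ (V := V)).mul (liesOver_matU θ₁ θ₂ h₁ h₂).inv)).mul (liesOver_matZ h)
  refine this.of_eq ?_
  simp [Matrix.adjugate_fin_two_of]

theorem liesOver_upsideDown (h χ : RPlus V) : ∃ s : ℝ, 0 < s ∧
    LiesOver (upsideDown h χ) !![0, s⁻¹; -s, 0] := by
  refine ⟨_, (rsqrt χ).2.2, ?_⟩
  have := ((liesOver_matJ (V := V)).mul (liesOver_matD' (rsqrt χ))).mul (liesOver_matZ h)
  refine this.of_eq ?_
  simp

/-- A real two by two matrix with positive diagonal and nonpositive off-diagonal entries. Such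
matrices form a monoid, as they are the conjugates by `diag(1, -1)` of matrices with nonnegative
entries. -/
def IsSignedPos (M : Matrix (Fin 2) (Fin 2) ℝ) : Prop :=
  0 < M 0 0 ∧ M 0 1 ≤ 0 ∧ M 1 0 ≤ 0 ∧ 0 < M 1 1

theorem IsSignedPos.mul {M N : Matrix (Fin 2) (Fin 2) ℝ} (hM : IsSignedPos M)
    (hN : IsSignedPos N) : IsSignedPos (M * N) := by
  obtain ⟨a, b, c, d⟩ := hM
  obtain ⟨a', b', c', d'⟩ := hN
  simp only [IsSignedPos, Matrix.mul_apply, Fin.sum_univ_two]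
  exact ⟨add_pos_of_pos_of_nonneg (mul_pos a a') (mul_nonneg_of_nonpos_of_nonpos b c'),
    add_nonpos (mul_nonpos_of_nonneg_of_nonpos a.le b') (mul_nonpos_of_nonpos_of_nonneg b d'.le),
    add_nonpos (mul_nonpos_of_nonpos_of_nonneg c a'.le) (mul_nonpos_of_nonneg_of_nonpos d.le c'),
    add_pos_of_nonneg_of_pos (mul_nonneg_of_nonpos_of_nonpos c b') (mul_pos d d')⟩

theorem IsSignedPos.trace_pos {M : Matrix (Fin 2) (Fin 2) ℝ} (hM : IsSignedPos M) :
    0 < M.trace := by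
  rw [Matrix.trace_fin_two]
  exact add_pos hM.1 hM.2.2.2

end Body

namespace Fatgraph

variable {D : Type*} {τ : Fatgraph D} {V : Type*} [AddCommGroup V] [Module ℝ V]

/-- Up to a matrix in the monoid `IsSignedPos`, a step contributes one sign for a left turn and one
for a passage in the direction of the orientation. -/
theorem Coordinates.stepElt_liesOver (C : τ.Coordinates V) (ω ω' : τ.Orientation) (x : D)
    (t : Turn) : ∃ M, IsSignedPos M ∧
      LiesOver (C.stepElt ω ω' x t).left
        ((-1 : ℝ) ^ ((if t = .left then 1 else 0) + if ω.out (τ.exit x t) then 1 else 0) • M) := by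
  have h1 : LiesOver (if ω.out (τ.exit x t) then ofMat (matZneg V) else 1 : SuperGroup V).left
      ((-1 : ℝ) ^ (if ω.out (τ.exit x t) then 1 else 0) • 1) := by
    split_ifs
    · simpa [ofMat] using liesOver_matZneg (V := V)
    · simpa using LiesOver.one (V := V)
  have h2 : LiesOver (if ω.out (τ.exit x t) = ω'.out (τ.exit x t) then 1 else psiElt V :
      SuperGroup V).left 1 := by
    split_ifs
    · exact LiesOver.one
    · exact LiesOver.one
  obtain ⟨s, hs, h3⟩ := liesOver_upsideDown (C.ratio (τ.exit x t)) (C.crossRatio (τ.exit x t))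
  have h3' : LiesOver (ofMat (upsideDown (C.ratio (τ.exit x t))
    (C.crossRatio (τ.exit x t)))).left _ := h3
  cases t with
  | left =>
    have h4 : LiesOver (ofMat (C.turnElt x .left)).left _ := liesOver_prime _ _ _ _ _ _
    refine ⟨!![s⁻¹, 0; -s, s], ⟨by simpa, by simp, by simpa using hs.le, by simpa⟩, ?_⟩
    refine (((h1.left_mul h2).left_mul h3').left_mul h4).of_eq ?_
    rw [pow_add, mul_one, smul_mul_assoc, one_mul, smul_mul_assoc, mul_comm, mul_smul]
    congr 1
    simp
  | right =>
    have h4 : LiesOver (ofMat (C.turnElt x .right)).left _ := (liesOver_prime _ _ _ _ _ _).inv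
    refine ⟨!![s⁻¹, -s⁻¹; 0, s], ⟨by simpa, by simpa using hs.le, by simp, by simpa⟩, ?_⟩
    refine (((h1.left_mul h2).left_mul h3').left_mul h4).of_eq ?_
    rw [pow_add, mul_one, smul_mul_assoc, one_mul, smul_mul_assoc, mul_comm, mul_smul]
    congr 1
    simp [Matrix.adjugate_fin_two_of]

theorem Coordinates.pathElt_liesOver (C : τ.Coordinates V) (ω ω' : τ.Orientation) (w : List Turn)
    (x : D) : ∃ M, IsSignedPos M ∧
      LiesOver (C.pathElt ω ω' x w).left
        ((-1 : ℝ) ^ (w.count .left + (τ.exits x w).countP fun y => ω.out y) • M) := by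
  induction w generalizing x with
  | nil =>
    exact ⟨1, by simp [IsSignedPos], by simpa [pathElt, exits] using LiesOver.one (V := V)⟩
  | cons t w ih =>
    obtain ⟨M, hM, h⟩ := ih (τ.ι (τ.exit x t))
    obtain ⟨N, hN, h'⟩ := C.stepElt_liesOver ω ω' x t
    refine ⟨M * N, hM.mul hN, ?_⟩
    refine (h.left_mul h').of_eq ?_
    rw [smul_mul_smul_comm, ← pow_add]
    congr 2
    simp only [exits, List.count_cons, List.countP_cons, beq_iff_eq]
    ring

theorem ClosedPath.length_exits (w : List Turn) (x : D) : (τ.exits x w).length = w.length := by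
  induction w generalizing x with
  | nil => rfl
  | cons t w ih => simp [exits, ih]

/-- The sign of the trace of the lift counts left turns and passages in the direction of the
orientation. -/
theorem Coordinates.quadForm_eq (C : τ.Coordinates V) (ω ω' : τ.Orientation) (γ : τ.ClosedPath) :
    C.quadForm ω ω' γ = (-1) ^ (γ.numLeft + γ.numSame ω) := by
  obtain ⟨M, hM, h⟩ := C.pathElt_liesOver ω ω' γ.turns γ.start
  have h' : C.rhoTilde ω ω' γ = _ := h.proj_eq
  rw [quadForm, h', Matrix.trace_smul, smul_eq_mul]
  change ((SignType.sign ((-1) ^ (γ.numLeft + γ.numSame ω) * M.trace) : SignType) : ℤ) = _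
  rcases neg_one_pow_eq_or ℝ (γ.numLeft + γ.numSame ω) with e | e
  · rw [e, one_mul, sign_pos hM.trace_pos]
    rw [neg_one_pow_eq_one_iff_even (by norm_num)] at e
    rw [e.neg_one_pow]; rfl
  · rw [e, neg_one_mul, sign_neg (neg_neg_of_pos hM.trace_pos)]
    rw [neg_one_pow_eq_neg_one_iff_odd (by norm_num)] at e
    rw [e.neg_one_pow]; rfl

theorem ClosedPath.numLeft_add_numRight (γ : τ.ClosedPath) :
    γ.numLeft + γ.numRight = γ.turns.length := by
  unfold numLeft numRight
  induction γ.turns with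
  | nil => rfl
  | cons t w ih => cases t <;> simp <;> omega

theorem ClosedPath.numSame_add_numOpposite (γ : τ.ClosedPath) (ω : τ.Orientation) :
    γ.numSame ω + γ.numOpposite ω = γ.turns.length := by
  rw [← length_exits (τ := τ) γ.turns γ.start, numSame, numOpposite,
    List.length_eq_countP_add_countP (fun y => ω.out y)]
  simp [edges]

theorem Coordinates.quadForm_eq_right (C : τ.Coordinates V) (ω ω' : τ.Orientation)
    (γ : τ.ClosedPath) :
    C.quadForm ω ω' γ = (-1) ^ (γ.numRight + γ.numOpposite ω) := by
  rw [C.quadForm_eq, neg_one_pow_congr]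
  have h1 := γ.numLeft_add_numRight
  have h2 := γ.numSame_add_numOpposite ω
  grind

end Fatgraph

/-! ### Weighted walks -/

section Walks

variable {α : Type*}

/-- `Walk R a l b s`: there is a chain of `R`-steps from `a` through the elements of `l`, in order,
where `R x y t` is a step from `x` to `y` of weight `t`. It ends at `b`, which is the last element
of `l` (or `a`, if `l` is empty), and `s` is the sum of the weights. A closed walk is one with
`b = a`; its list does not begin with `a` but ends with it. -/
inductive Walk (R : α → α → ZMod 2 → Prop) : α → List α → α → ZMod 2 → Prop
  | nil (a : α) : Walk R a [] a 0
  | cons {a b c : α} {l : List α} {s t : ZMod 2} :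
    R a b s → Walk R b l c t → Walk R a (b :: l) c (s + t)

namespace Walk

variable {R R' : α → α → ZMod 2 → Prop} {a b c : α} {l m : List α} {s t : ZMod 2}

theorem of_eq (h : Walk R a l b s) (hs : s = t) : Walk R a l b t := hs ▸ h

theorem append (h : Walk R a l b s) (h' : Walk R b m c t) : Walk R a (l ++ m) c (s + t) := by
  induction h with
  | nil => simpa
  | cons hR _ ih =>
    rw [add_assoc]
    exact cons hR (ih h')

theorem exists_of_append (h : Walk R a (l ++ m) c s) :
    ∃ b s₁ s₂, Walk R a l b s₁ ∧ Walk R b m c s₂ ∧ s = s₁ + s₂ := by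
  induction l generalizing a s with
  | nil => exact ⟨a, 0, s, nil a, h, (zero_add s).symm⟩
  | cons x l ih =>
    obtain _ | ⟨hR, h⟩ := h
    obtain ⟨b, s₁, s₂, h₁, h₂, rfl⟩ := ih h
    exact ⟨b, _, s₂, cons hR h₁, h₂, (add_assoc _ _ _).symm⟩

theorem eq_getLastD (h : Walk R a l b s) : b = l.getLastD a := by
  induction h with
  | nil => rfl
  | cons _ _ ih => rw [List.getLastD_cons]; exact ih

/-- A change of the weights of the steps by a coboundary. -/
theorem gauge (f : α → ZMod 2) (hR : ∀ a b s, R a b s → R' a b (s + f a + f b))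
    (h : Walk R a l b s) : Walk R' a l b (s + f a + f b) := by
  induction h with
  | nil a =>
    rw [zero_add, CharTwo.add_self_eq_zero]
    exact nil a
  | @cons a b c l s t hs h ih =>
    convert cons (hR _ _ _ hs) ih using 1
    have := CharTwo.add_self_eq_zero (f b)
    linear_combination -this

theorem weight_unique (hR : ∀ a b s t, R a b s → R a b t → s = t) (h : Walk R a l b s)
    (h' : Walk R a l c t) : s = t := by
  induction h generalizing c t with
  | nil => cases h'; rfl
  | cons hs _ ih =>
    obtain _ | ⟨hs', h'⟩ := h'
    rw [hR _ _ _ _ hs hs', ih h']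

theorem of_isRotated (h : Walk R a l a s) (hl : l ~r m) : ∃ b, Walk R b m b s := by
  obtain ⟨n, hn, rfl⟩ := List.isRotated_iff_mod.1 hl
  rw [List.rotate_eq_drop_append_take hn]
  rw [← List.take_append_drop n l] at h
  obtain ⟨b, s₁, s₂, h₁, h₂, rfl⟩ := h.exists_of_append
  rw [add_comm]
  exact ⟨b, h₂.append h₁⟩

theorem closed_weight_unique (hR : ∀ a b s t, R a b s → R a b t → s = t) (h : Walk R a l a s)
    (h' : Walk R b m b t) (hl : l ~r m) : s = t := by
  obtain ⟨c, h⟩ := h.of_isRotated hl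
  cases m with
  | nil => cases h; cases h'; rfl
  | cons x m =>
    have e : c = b := by
      rw [h.eq_getLastD, h'.eq_getLastD, List.getLastD_cons, List.getLastD_cons]
    subst e
    exact h.weight_unique hR h'

end Walk

theorem _root_.List.IsRotated.filter {l m : List α} (h : l ~r m) (p : α → Bool) :
    l.filter p ~r m.filter p := by
  obtain ⟨n, hn, rfl⟩ := List.isRotated_iff_mod.1 h
  rw [List.rotate_eq_drop_append_take hn]
  nth_rewrite 1 [← List.take_append_drop n l]
  rw [List.filter_append, List.filter_append]
  exact List.isRotated_append

/-- The steps between elements that satisfy `p`, which either are steps for `R` or consist of two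
steps for `R` by way of an element that does not satisfy `p`. -/
def collapseRel (p : α → Prop) (R : α → α → ZMod 2 → Prop) (a b : α) (s : ZMod 2) : Prop :=
  p a ∧ p b ∧ (R a b s ∨ ∃ m s₁ s₂, ¬ p m ∧ R a m s₁ ∧ R m b s₂ ∧ s = s₁ + s₂)

namespace Walk

variable {R : α → α → ZMod 2 → Prop} {p : α → Prop} [DecidablePred p] {a b : α} {l : List α}
  {s : ZMod 2}

theorem collapse (hR : ∀ a b s, ¬ p a → R a b s → p b) (h : Walk R a l b s) (ha : p a)
    (hb : p b) : Walk (collapseRel p R) a (l.filter p) b s := by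
  suffices H : (p a → Walk (collapseRel p R) a (l.filter p) b s) ∧
      (¬ p a → ∀ z t, p z → R z a t → Walk (collapseRel p R) z (l.filter p) b (t + s)) from H.1 ha
  clear ha
  induction h with
  | nil a => exact ⟨fun _ => nil a, fun h => absurd hb h⟩
  | @cons x y z l s t hs h ih =>
    obtain ⟨ih₁, ih₂⟩ := ih hb
    constructor
    · intro hx
      by_cases hy : p y
      · rw [List.filter_cons_of_pos (by simpa using hy)]
        exact cons ⟨hx, hy, Or.inl hs⟩ (ih₁ hy)
      · rw [List.filter_cons_of_neg (by simpa using hy)]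
        exact ih₂ hy x s hx hs
    · intro hx w r hw hr
      have hy := hR x y s hx hs
      rw [List.filter_cons_of_pos (by simpa using hy), ← add_assoc]
      exact cons ⟨hw, hy, Or.inr ⟨x, r, s, hx, hr, hs, rfl⟩⟩ (ih₁ hy)

theorem exists_of_collapse (h : Walk (collapseRel p R) a l b s) :
    ∃ m, m.filter p = l ∧ Walk R a m b s := by
  induction h with
  | nil a => exact ⟨[], rfl, nil a⟩
  | @cons x y z l s t hs _ ih =>
    obtain ⟨m, rfl, h⟩ := ih
    obtain ⟨-, hy, hs | ⟨w, s₁, s₂, hw, h₁, h₂, rfl⟩⟩ := hs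
    · exact ⟨y :: m, List.filter_cons_of_pos (by simpa using hy), cons hs h⟩
    · refine ⟨w :: y :: m, ?_, ?_⟩
      · rw [List.filter_cons_of_neg (by simpa using hw),
          List.filter_cons_of_pos (by simpa using hy)]
      · rw [add_assoc]
        exact cons h₁ (cons h₂ h)

/-- A closed walk can be rotated so that it starts from an element that satisfies `p`. -/
theorem exists_rotation (hR : ∀ a b s, ¬ p a → R a b s → p b) (hp : ∃ x, p x)
    (h : Walk R a l a s) : ∃ b m, p b ∧ l ~r m ∧ Walk R b m b s := by
  by_cases ha : p a
  · exact ⟨a, l, ha, List.IsRotated.refl l, h⟩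
  · cases h with
    | nil =>
      obtain ⟨x, hx⟩ := hp
      exact ⟨x, [], hx, List.IsRotated.refl _, nil x⟩
    | @cons _ y _ l s t hs h =>
      refine ⟨y, l ++ [y], hR a y s ha hs, (List.isRotated_append (l := [y]) (l' := l)), ?_⟩
      have := h.append (cons hs (nil y))
      rwa [add_zero, add_comm] at this

end Walk

end Walks

namespace Fatgraph

variable {D : Type*} {τ : Fatgraph D}

theorem σ_symm (x : D) : τ.σ.symm x = τ.σ (τ.σ x) := by
  rw [Equiv.symm_apply_eq, τ.σ_cube]

theorem σ_σ_ne (x : D) : τ.σ (τ.σ x) ≠ x := fun h => by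
  have := τ.σ_cube x
  rw [h] at this
  exact τ.σ_ne x this

/-! ### Closed paths as closed walks -/

variable (τ) in
/-- A path that leaves a vertex along the half-edge `y` can leave the next one along `z`. The weight
is `o z`, and one more for a left turn. -/
def turnRel (o : D → ZMod 2) (y z : D) (s : ZMod 2) : Prop :=
  (z = τ.σ (τ.σ (τ.ι y)) ∧ s = 1 + o z) ∨ (z = τ.σ (τ.ι y) ∧ s = o z)

theorem turnRel_unique {o : D → ZMod 2} (y z : D) (s t : ZMod 2) (h : τ.turnRel o y z s)
    (h' : τ.turnRel o y z t) : s = t := by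
  have := τ.σ_ne (τ.σ (τ.ι y))
  unfold turnRel at h h'
  grind

/-- The indicator of the half-edges along which a vertex is left in the direction of the
orientation. -/
def Orientation.bit (ω : τ.Orientation) (x : D) : ZMod 2 := if ω.out x then 1 else 0

theorem Orientation.bit_ι (ω : τ.Orientation) (x : D) : ω.bit (τ.ι x) = ω.bit x + 1 := by
  unfold bit
  rw [ω.out_ι]
  cases ω.out x <;> decide

/-- The entry half-edge of a path, whose other half is `y`, is where its walk starts; the walk then
passes through the exits. -/
theorem walk_exits (ω : τ.Orientation) (w : List Turn) (y : D) :
    Walk (τ.turnRel ω.bit) y (τ.exits (τ.ι y) w) (τ.ι (τ.endpoint (τ.ι y) w))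
      ((w.count .left + (τ.exits (τ.ι y) w).countP fun y => ω.out y : ℕ) : ZMod 2) := by
  induction w generalizing y with
  | nil => simpa [exits, endpoint, τ.ι_ι] using Walk.nil y
  | cons t w ih =>
    have h := ih (τ.exit (τ.ι y) t)
    have hs : τ.turnRel ω.bit y (τ.exit (τ.ι y) t)
        ((if t = .left then 1 else 0) + ω.bit (τ.exit (τ.ι y) t)) := by
      cases t
      · exact Or.inl ⟨σ_symm _, rfl⟩
      · exact Or.inr ⟨rfl, by simp⟩
    refine (Walk.cons hs h).of_eq ?_
    simp only [exits, List.count_cons, List.countP_cons, beq_iff_eq, Orientation.bit]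
    push_cast
    ring

theorem ClosedPath.walk (γ : τ.ClosedPath) (ω : τ.Orientation) :
    Walk (τ.turnRel ω.bit) (τ.ι γ.start) γ.edges (τ.ι γ.start)
      ((γ.numLeft + γ.numSame ω : ℕ) : ZMod 2) := by
  have h := walk_exits ω γ.turns (τ.ι γ.start)
  rw [τ.ι_ι, γ.closed] at h
  exact h

theorem exists_turns_of_walk {o : D → ZMod 2} {a b : D} {l : List D} {s : ZMod 2}
    (h : Walk (τ.turnRel o) a l b s) :
    ∃ w, τ.exits (τ.ι a) w = l ∧ τ.endpoint (τ.ι a) w = τ.ι b := by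
  induction h with
  | nil a => exact ⟨[], rfl, rfl⟩
  | @cons a b c l s t hs _ ih =>
    obtain ⟨w, hw, hw'⟩ := ih
    obtain ⟨hb, -⟩ | ⟨hb, -⟩ := hs
    · have e : τ.exit (τ.ι a) .left = b := (σ_symm _).trans hb.symm
      exact ⟨.left :: w, by simp [exits, e, hw], by simp [endpoint, e, hw']⟩
    · have e : τ.exit (τ.ι a) .right = b := hb.symm
      exact ⟨.right :: w, by simp [exits, e, hw], by simp [endpoint, e, hw']⟩

theorem exists_closedPath_of_walk {o : D → ZMod 2} {a : D} {l : List D} {s : ZMod 2}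
    (h : Walk (τ.turnRel o) a l a s) : ∃ γ : τ.ClosedPath, γ.edges = l := by
  obtain ⟨w, hw, hw'⟩ := exists_turns_of_walk h
  exact ⟨⟨τ.ι a, w, hw'⟩, hw⟩

/-- Values of the quadratic form are compared through the parities of the exponents, the weights of
the closed paths. -/
theorem quadForm_eq_quadForm_iff {τ' : Fatgraph D} {V : Type*} [AddCommGroup V] [Module ℝ V]
    (C : τ.Coordinates V) (ω ωι : τ.Orientation) (γ : τ.ClosedPath)
    (C' : τ'.Coordinates V) (ω' ωι' : τ'.Orientation) (γ' : τ'.ClosedPath) :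
    C'.quadForm ω' ωι' γ' = C.quadForm ω ωι γ ↔
      ((γ'.numLeft + γ'.numSame ω' : ℕ) : ZMod 2) = ((γ.numLeft + γ.numSame ω : ℕ) : ZMod 2) := by
  rw [C'.quadForm_eq, C.quadForm_eq, ZMod.natCast_eq_natCast_iff']
  generalize γ'.numLeft + γ'.numSame ω' = m
  generalize γ.numLeft + γ.numSame ω = n
  rcases Nat.even_or_odd m with hm | hm <;> rcases Nat.even_or_odd n with hn | hn <;>
    simp [hm.neg_one_pow, hn.neg_one_pow] <;> grind

/-! ### Reflections -/

theorem sameVertex_σ {x y : D} : τ.SameVertex x (τ.σ y) ↔ τ.SameVertex x y := by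
  have h1 := τ.σ_cube x
  have h2 := τ.σ_cube y
  unfold SameVertex
  grind

theorem SameVertex.symm {x y : D} (h : τ.SameVertex x y) : τ.SameVertex y x := by
  have h1 := τ.σ_cube x
  unfold SameVertex at h ⊢
  grind

theorem SameVertex.trans {x y z : D} (h : τ.SameVertex x y) (h' : τ.SameVertex y z) :
    τ.SameVertex x z := by
  have h1 := τ.σ_cube x
  have h2 := τ.σ_cube y
  unfold SameVertex at h h' ⊢
  grind

/-- Modifying an orientation by the coboundary of a function of the vertices modifies the weights
of the turns by a coboundary. -/
theorem turnRel_gauge {o o' g : D → ZMod 2} (hg : ∀ x, g (τ.σ x) = g x)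
    (ho : ∀ x, o' x = o x + g x + g (τ.ι x)) (y z : D) (s : ZMod 2) (h : τ.turnRel o y z s) :
    τ.turnRel o' y z (s + g (τ.ι y) + g (τ.ι z)) := by
  obtain ⟨rfl, rfl⟩ | ⟨rfl, rfl⟩ := h
  · refine Or.inl ⟨rfl, ?_⟩
    rw [ho, hg, hg]; ring
  · refine Or.inr ⟨rfl, ?_⟩
    rw [ho, hg]

variable [DecidableEq D]

/-- The indicator of the half-edges at the vertex of `v`. -/
def vertexBit (τ : Fatgraph D) (v x : D) : ZMod 2 := if τ.SameVertex v x then 1 else 0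

theorem vertexBit_σ (v x : D) : τ.vertexBit v (τ.σ x) = τ.vertexBit v x := by
  simp only [vertexBit, sameVertex_σ]

theorem Orientation.bit_reflect (ω : τ.Orientation) (v x : D) :
    (ω.reflect v).bit x = ω.bit x + τ.vertexBit v x + τ.vertexBit v (τ.ι x) := by
  unfold bit vertexBit reflect
  by_cases h1 : τ.SameVertex v x <;> by_cases h2 : τ.SameVertex v (τ.ι x) <;>
    simp only [h1, h2] <;> cases ω.out x <;> decide

theorem ClosedPath.weight_eq_of_reflect (ω : τ.Orientation) (v : D) (γ : τ.ClosedPath) :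
    ((γ.numLeft + γ.numSame (ω.reflect v) : ℕ) : ZMod 2) =
      ((γ.numLeft + γ.numSame ω : ℕ) : ZMod 2) := by
  have h := (γ.walk ω).gauge _ (turnRel_gauge (vertexBit_σ v) (ω.bit_reflect v))
  rw [add_assoc, CharTwo.add_self_eq_zero, add_zero] at h
  exact (γ.walk _).weight_unique turnRel_unique h

/-- The weight of a closed path depends only on the class of the orientation, since it leaves every
vertex as often as it enters it. -/
theorem ClosedPath.weight_eq_of_equivalent {ω ω₁ : τ.Orientation} (h : ω.Equivalent ω₁)
    (γ : τ.ClosedPath) :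
    ((γ.numLeft + γ.numSame ω₁ : ℕ) : ZMod 2) = ((γ.numLeft + γ.numSame ω : ℕ) : ZMod 2) := by
  induction h with
  | refl => rfl
  | tail _ h ih =>
    obtain ⟨v, rfl⟩ := h
    rw [γ.weight_eq_of_reflect, ih]

end Fatgraph

namespace Fatgraph

variable {D : Type*} {τ : Fatgraph D}

/-! ### Collapsing an edge -/

/-- An edge with different ends is not passed twice in a row. -/
theorem turnRel_ne {o : D → ZMod 2} {e : D} (he : ¬ τ.SameVertex e (τ.ι e)) (a b : D)
    (s : ZMod 2) (ha : ¬ (a ≠ e ∧ a ≠ τ.ι e)) (h : τ.turnRel o a b s) : b ≠ e ∧ b ≠ τ.ι e := by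
  have h1 := τ.σ_ne
  have h2 := τ.σ_σ_ne
  have h3 := τ.σ_cube
  have h4 := τ.ι_ι
  unfold turnRel at h
  unfold SameVertex at he
  grind

/-- The six half-edges at two different vertices are different. -/
theorem ne_of_not_sameVertex {e f : D} (he : ¬ τ.SameVertex e f) :
    (e ≠ f ∧ e ≠ τ.σ f ∧ e ≠ τ.σ (τ.σ f)) ∧
    (τ.σ e ≠ f ∧ τ.σ e ≠ τ.σ f ∧ τ.σ e ≠ τ.σ (τ.σ f)) ∧
    (τ.σ (τ.σ e) ≠ f ∧ τ.σ (τ.σ e) ≠ τ.σ f ∧ τ.σ (τ.σ e) ≠ τ.σ (τ.σ f)) := by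
  have h3 := τ.σ_cube
  have h4 := τ.σ.injective
  unfold SameVertex at he
  refine ⟨⟨?_, ?_, ?_⟩, ⟨?_, ?_, ?_⟩, ⟨?_, ?_, ?_⟩⟩ <;> intro h <;> grind

/-- The steps of a path that enters along the branch after `e`: to one of the three other branches
at the ends of the collapsed edge, the last two by way of the edge. -/
theorem collapseRel_of_enter_first {o : D → ZMod 2} {e f : D} (hf : τ.ι e = f)
    (he : ¬ τ.SameVertex e f) {a : D} (ha : τ.ι a = τ.σ e) (b : D) (s : ZMod 2) :
    collapseRel (fun x => x ≠ e ∧ x ≠ f) (τ.turnRel o) a b s ↔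
      (b = τ.σ (τ.σ e) ∧ s = o b) ∨ (b = τ.σ f ∧ s = 1 + o e + o b) ∨
        (b = τ.σ (τ.σ f) ∧ s = o e + o b) := by
  obtain ⟨⟨n1, n2, n3⟩, ⟨n4, n5, n6⟩, n7, n8, n9⟩ := ne_of_not_sameVertex he
  have h1 := τ.σ_ne
  have h2 := τ.σ_σ_ne
  have h3 := τ.σ_cube e
  have h4 := τ.ι_ι e
  have h5 : (1 : ZMod 2) + 1 = 0 := by decide
  have ha1 : a ≠ e := by grind
  have ha2 : a ≠ f := by grind
  simp only [collapseRel, turnRel, ha, h3]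
  constructor
  · rintro ⟨-, hb, h | ⟨m, s₁, s₂, hm, h, h', rfl⟩⟩
    · grind
    · obtain rfl : m = e := by grind
      rw [hf] at h'
      grind
  · rintro (⟨rfl, rfl⟩ | ⟨rfl, rfl⟩ | ⟨rfl, rfl⟩)
    · exact ⟨⟨ha1, ha2⟩, ⟨h2 e, n7⟩, Or.inl (Or.inr ⟨rfl, rfl⟩)⟩
    · exact ⟨⟨ha1, ha2⟩, ⟨n2.symm, h1 f⟩, Or.inr ⟨e, 1 + o e, o (τ.σ f), by simp,
        Or.inl ⟨rfl, rfl⟩, Or.inr ⟨by rw [hf], rfl⟩, rfl⟩⟩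
    · exact ⟨⟨ha1, ha2⟩, ⟨n3.symm, h2 f⟩, Or.inr ⟨e, 1 + o e, 1 + o (τ.σ (τ.σ f)), by simp,
        Or.inl ⟨rfl, rfl⟩, Or.inl ⟨by rw [hf], rfl⟩, by linear_combination -h5⟩⟩

/-- The steps of a path that enters along the second branch after `e`. -/
theorem collapseRel_of_enter_second {o : D → ZMod 2} {e f : D} (hf : τ.ι e = f)
    (he : ¬ τ.SameVertex e f) {a : D} (ha : τ.ι a = τ.σ (τ.σ e)) (b : D) (s : ZMod 2) :
    collapseRel (fun x => x ≠ e ∧ x ≠ f) (τ.turnRel o) a b s ↔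
      (b = τ.σ e ∧ s = 1 + o b) ∨ (b = τ.σ f ∧ s = o e + o b) ∨
        (b = τ.σ (τ.σ f) ∧ s = 1 + o e + o b) := by
  obtain ⟨⟨n1, n2, n3⟩, ⟨n4, n5, n6⟩, n7, n8, n9⟩ := ne_of_not_sameVertex he
  have h1 := τ.σ_ne
  have h2 := τ.σ_σ_ne
  have h3 := τ.σ_cube e
  have h4 := τ.ι_ι e
  have ha1 : a ≠ e := by grind
  have ha2 : a ≠ f := by grind
  simp only [collapseRel, turnRel, ha, h3]
  constructor
  · rintro ⟨-, hb, h | ⟨m, s₁, s₂, hm, h, h', rfl⟩⟩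
    · grind
    · obtain rfl : m = e := by grind
      rw [hf] at h'
      grind
  · rintro (⟨rfl, rfl⟩ | ⟨rfl, rfl⟩ | ⟨rfl, rfl⟩)
    · exact ⟨⟨ha1, ha2⟩, ⟨h1 e, n4⟩, Or.inl (Or.inl ⟨rfl, rfl⟩)⟩
    · exact ⟨⟨ha1, ha2⟩, ⟨n2.symm, h1 f⟩, Or.inr ⟨e, o e, o (τ.σ f), by simp,
        Or.inr ⟨rfl, rfl⟩, Or.inr ⟨by rw [hf], rfl⟩, rfl⟩⟩
    · exact ⟨⟨ha1, ha2⟩, ⟨n3.symm, h2 f⟩, Or.inr ⟨e, o e, 1 + o (τ.σ (τ.σ f)), by simp,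
        Or.inr ⟨rfl, rfl⟩, Or.inl ⟨by rw [hf], rfl⟩, by ring⟩⟩

theorem collapseRel_of_not_mem {o : D → ZMod 2} {e f : D} {a : D} (hf : τ.ι e = f)
    (h₁ : ¬ τ.SameVertex e (τ.ι a)) (h₂ : ¬ τ.SameVertex f (τ.ι a)) (b : D) (s : ZMod 2) :
    collapseRel (fun x => x ≠ e ∧ x ≠ f) (τ.turnRel o) a b s ↔ τ.turnRel o a b s := by
  have h1 := τ.σ_ne
  have h2 := τ.σ_σ_ne
  have h3 := τ.σ_cube
  have h4 := τ.ι_ι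
  unfold SameVertex at h₁ h₂
  unfold collapseRel turnRel
  constructor
  · rintro ⟨ha, hb, h | ⟨m, s₁, s₂, hm, h, -⟩⟩
    · exact h
    · grind
  · intro h
    grind

/-! ### The flip -/

variable [DecidableEq D]

theorem flip_σ_quarterTurn (e x : D) :
    (τ.flip e).σ (τ.quarterTurn e x) = τ.quarterTurn e (τ.σ x) := by
  simp [flip]

theorem quarterTurn_table {e f : D} (hf : τ.ι e = f) (he : ¬ τ.SameVertex e f) :
    τ.quarterTurn e (τ.σ e) = τ.σ (τ.σ e) ∧ τ.quarterTurn e (τ.σ (τ.σ e)) = τ.σ f ∧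
    τ.quarterTurn e (τ.σ f) = τ.σ (τ.σ f) ∧ τ.quarterTurn e (τ.σ (τ.σ f)) = τ.σ e ∧
    ∀ x, x ≠ τ.σ e → x ≠ τ.σ (τ.σ e) → x ≠ τ.σ f → x ≠ τ.σ (τ.σ f) →
      τ.quarterTurn e x = x := by
  have h1 := τ.σ_ne
  have h2 := τ.σ_σ_ne
  have h3 := τ.σ_cube
  unfold SameVertex at he
  subst hf
  simp only [quarterTurn, List.formPerm_cons_cons, List.formPerm_singleton, mul_one,
    Equiv.Perm.mul_apply, Equiv.swap_apply_def]
  grind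

/-- The rotation of the flip: its vertices at the edge are `(e, σ² e, σ f)` and
`(f, σ² f, σ e)`. -/
theorem flip_table {e f : D} (hf : τ.ι e = f) (he : ¬ τ.SameVertex e f) :
    (τ.flip e).σ e = τ.σ (τ.σ e) ∧ (τ.flip e).σ (τ.σ (τ.σ e)) = τ.σ f ∧
    (τ.flip e).σ (τ.σ f) = e ∧
    (τ.flip e).σ f = τ.σ (τ.σ f) ∧ (τ.flip e).σ (τ.σ (τ.σ f)) = τ.σ e ∧
    (τ.flip e).σ (τ.σ e) = f ∧
    ∀ x, ¬ τ.SameVertex e x → ¬ τ.SameVertex f x → (τ.flip e).σ x = τ.σ x := by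
  obtain ⟨qA, qB, qC, qD, q⟩ := quarterTurn_table hf he
  obtain ⟨⟨n1, n2, n3⟩, ⟨n4, n5, n6⟩, n7, n8, n9⟩ := ne_of_not_sameVertex he
  have qe := q e (τ.σ_ne e).symm (τ.σ_σ_ne e).symm n2 n3
  have qf := q f n4.symm n7.symm (τ.σ_ne f).symm (τ.σ_σ_ne f).symm
  have key := flip_σ_quarterTurn (τ := τ) e
  refine ⟨?_, ?_, ?_, ?_, ?_, ?_, fun x hx hx' => ?_⟩
  · have := key e
    rwa [qe, qA] at this
  · have := key (τ.σ e)
    rwa [qA, qB] at this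
  · have := key (τ.σ (τ.σ e))
    rwa [qB, τ.σ_cube, qe] at this
  · have := key f
    rwa [qf, qC] at this
  · have := key (τ.σ f)
    rwa [qC, qD] at this
  · have := key (τ.σ (τ.σ f))
    rwa [qD, τ.σ_cube, qf] at this
  · have hσ : ∀ y, ¬ τ.SameVertex e y → ¬ τ.SameVertex f y → τ.quarterTurn e y = y := by
      intro y hy hy'
      unfold SameVertex at hy hy'
      push Not at hy hy'
      exact q y hy.2.1 hy.2.2 hy'.2.1 hy'.2.2
    have := key x
    rwa [hσ x hx hx', hσ _ (by rwa [sameVertex_σ]) (by rwa [sameVertex_σ])] at this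

theorem flip_not_sameVertex {e f : D} (hf : τ.ι e = f) (he : ¬ τ.SameVertex e f) :
    ¬ (τ.flip e).SameVertex e f := by
  obtain ⟨h1, h2, -⟩ := flip_table hf he
  obtain ⟨⟨n1, -⟩, -, n7, -⟩ := ne_of_not_sameVertex he
  unfold SameVertex
  rw [h1, h2]
  push Not
  exact ⟨n1.symm, n7.symm, (τ.σ_ne f).symm⟩

/-- The flip does not depend on the choice of one of the two halves of the edge. -/
theorem flip_ι_eq {e : D} (he : ¬ τ.SameVertex e (τ.ι e)) : τ.flip (τ.ι e) = τ.flip e := by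
  have h : τ.quarterTurn (τ.ι e) = τ.quarterTurn e := by
    obtain ⟨-, ⟨n4, n5, n6⟩, n7, n8, n9⟩ := ne_of_not_sameVertex he
    unfold quarterTurn
    rw [τ.ι_ι]
    refine List.formPerm_eq_of_isRotated ?_ ⟨2, rfl⟩
    simp only [List.nodup_cons, List.mem_cons, List.not_mem_nil, or_false, not_or,
      List.nodup_nil, and_true, not_false_eq_true]
    exact ⟨⟨(τ.σ_ne _).symm, n5.symm, n8.symm⟩, ⟨n6.symm, n9.symm⟩, (τ.σ_ne _).symm⟩
  unfold flip
  simp only [h]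

/-- On the graph with the edge collapsed, the weights of the fatgraph and of its flip differ by a
coboundary, that of the indicator of the other half of the branch `σ e`. Here `e` is the half of
the edge at its head (`h0`), and `o'` is `o` with the edge of the branch `σ e` reversed. -/
theorem collapseRel_flip {o o' : D → ZMod 2} {e f : D} (hf : τ.ι e = f)
    (he : ¬ τ.SameVertex e f) (ho : ∀ x, o (τ.ι x) = o x + 1) (h0 : o e = 0)
    (ho' : ∀ x, o' x = o x + if x = τ.σ e ∨ x = τ.ι (τ.σ e) then 1 else 0) (a b : D)
    (s : ZMod 2) :
    collapseRel (fun x => x ≠ e ∧ x ≠ f) (τ.turnRel o) a b s ↔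
    collapseRel (fun x => x ≠ e ∧ x ≠ f) ((τ.flip e).turnRel o') a b
      (s + (if τ.ι a = τ.σ e then 1 else 0) + (if τ.ι b = τ.σ e then 1 else 0)) := by
  obtain ⟨tA, tB, -, tD, tE, -, t⟩ := flip_table hf he
  obtain ⟨⟨n1, n2, n3⟩, ⟨n4, n5, n6⟩, n7, n8, n9⟩ := ne_of_not_sameVertex he
  have he' : ¬ τ.SameVertex f e := fun h => he h.symm
  have hfe : τ.ι f = e := by rw [← hf, τ.ι_ι]
  have hF := flip_not_sameVertex hf he
  have hF' : ¬ (τ.flip e).SameVertex f e := fun h => hF h.symm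
  have hι : (τ.flip e).ι = τ.ι := rfl
  have h1f : o f = 1 := by rw [← hf, ho, h0, zero_add]
  have h0' : o' e = 0 := by
    rw [ho', h0, zero_add, if_neg]
    have := τ.σ_ne e
    have := τ.ι_ι (τ.σ e)
    grind
  have h1f' : o' f = 1 := by
    rw [ho', h1f, if_neg, add_zero]
    have := τ.σ_ne e
    have := τ.ι.injective
    grind
  have hb : ∀ x, o' x = o x + (if x = τ.σ e then 1 else 0) + if τ.ι x = τ.σ e then 1 else 0 := by
    intro x
    have h7 : x = τ.ι (τ.σ e) ↔ τ.ι x = τ.σ e :=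
      ⟨fun h => by rw [h, τ.ι_ι], fun h => by rw [← h, τ.ι_ι]⟩
    rw [ho']
    simp only [h7]
    have := τ.ι_ne x
    grind
  have comm : ∀ τ' : Fatgraph D, ∀ o, collapseRel (fun x => x ≠ e ∧ x ≠ f) (τ'.turnRel o) =
      collapseRel (fun x => x ≠ f ∧ x ≠ e) (τ'.turnRel o) := by
    intro τ' o
    simp only [and_comm]
  by_cases hpa : a ≠ e ∧ a ≠ f
  swap
  · exact ⟨fun h => absurd h.1 hpa, fun h => absurd h.1 hpa⟩
  have hae : τ.ι a ≠ e := fun h => hpa.2 (by rw [← hf, ← h, τ.ι_ι])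
  have haf : τ.ι a ≠ f := fun h => hpa.1 (by rw [← hfe, ← h, τ.ι_ι])
  -- The path comes in along `τ.ι a`, which is one of the four branches or is at another vertex.
  -- At a branch, either end of the edge can be in the role of `e`, before and after the flip.
  by_cases hx : τ.SameVertex e (τ.ι a) ∨ τ.SameVertex f (τ.ι a)
  · have hcases : τ.ι a = τ.σ e ∨ τ.ι a = τ.σ (τ.σ e) ∨ τ.ι a = τ.σ f ∨ τ.ι a = τ.σ (τ.σ f) := by
      unfold SameVertex at hx
      grind
    have hb' := hb b
    have n0 : τ.σ (τ.σ e) ≠ τ.σ e := τ.σ_ne _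
    rcases hcases with h | h | h | h
    · rw [collapseRel_of_enter_first hf he h, comm (τ.flip e),
        collapseRel_of_enter_second (τ := τ.flip e) hfe hF' (by rw [hι, h, tD, tE]), tD, tA, tB,
        h0, h1f', h, if_pos rfl]
      generalize (if τ.ι b = τ.σ e then (1 : ZMod 2) else 0) = i at hb' ⊢
      clear ho ho' hb t comm
      grind
    · rw [collapseRel_of_enter_second hf he h,
        collapseRel_of_enter_first (τ := τ.flip e) hf hF (by rw [hι, h, tA]), tD, tE, tA, tB,
        h0, h0', h, if_neg (τ.σ_ne _)]
      generalize (if τ.ι b = τ.σ e then (1 : ZMod 2) else 0) = i at hb' ⊢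
      clear ho ho' hb t comm
      grind
    · rw [comm τ, collapseRel_of_enter_first hfe he' h,
        collapseRel_of_enter_second (τ := τ.flip e) hf hF (by rw [hι, h, tA, tB]), tD, tE, tA,
        h1f, h0', h, if_neg n5.symm]
      generalize (if τ.ι b = τ.σ e then (1 : ZMod 2) else 0) = i at hb' ⊢
      clear ho ho' hb t comm
      grind
    · rw [comm τ, collapseRel_of_enter_second hfe he' h, comm (τ.flip e),
        collapseRel_of_enter_first (τ := τ.flip e) hfe hF' (by rw [hι, h, tD]), tD, tE, tA, tB,
        h1f, h1f', h, if_neg n6.symm]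
      generalize (if τ.ι b = τ.σ e then (1 : ZMod 2) else 0) = i at hb' ⊢
      clear ho ho' hb t comm
      grind
  · rw [not_or] at hx
    have hx' : ¬ (τ.flip e).SameVertex e (τ.ι a) ∧ ¬ (τ.flip e).SameVertex f (τ.ι a) := by
      unfold SameVertex at hx ⊢
      rw [tA, tB, tD, tE]
      grind
    rw [collapseRel_of_not_mem hf hx.1 hx.2,
      collapseRel_of_not_mem (τ := τ.flip e) hf hx'.1 hx'.2]
    have hs : τ.SameVertex e (τ.σ e) := Or.inr (Or.inl rfl)
    have n : ∀ y, ¬ τ.SameVertex e y → y ≠ τ.σ e := fun y hy h => hy (h ▸ hs)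
    have m1 := mt sameVertex_σ.1 hx.1
    have m2 := mt sameVertex_σ.1 hx.2
    unfold turnRel
    rw [hι, t _ hx.1 hx.2, t _ m1 m2, if_neg (n _ hx.1)]
    have k1 := n _ m1
    have k2 := n _ (mt sameVertex_σ.1 m1)
    have hb' := hb b
    generalize (if τ.ι b = τ.σ e then (1 : ZMod 2) else 0) = i at hb' ⊢
    grind

end Fatgraph

namespace Fatgraph

variable {D : Type*} {τ : Fatgraph D}

/-! ### Closed paths and orientations under the flip -/

theorem turnRel_sameVertex {o : D → ZMod 2} {y z : D} {s : ZMod 2} (h : τ.turnRel o y z s) :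
    τ.SameVertex (τ.ι y) z :=
  h.elim (fun h => Or.inr (Or.inr h.1)) fun h => Or.inr (Or.inl h.1)

theorem Orientation.bit_head (ω : τ.Orientation) (e : D) : ω.bit (ω.head e) = 0 := by
  unfold bit head
  cases h : ω.out e <;> simp [ω.out_ι, h]

section Flip

variable [DecidableEq D]

theorem Orientation.bit_flip (ω : τ.Orientation) (e x : D) :
    (ω.flip e).bit x =
      ω.bit x + if x = τ.σ (ω.head e) ∨ x = τ.ι (τ.σ (ω.head e)) then 1 else 0 := by
  unfold bit flip
  by_cases h : x = τ.σ (ω.head e) ∨ x = τ.ι (τ.σ (ω.head e)) <;>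
    simp only [h, if_true, if_false] <;> cases ω.out x <;> decide

/-- `collapseRel_flip` for the halves `ω.head e` and its opposite, whichever half `e` is. -/
theorem Orientation.exists_gauge_flip (ω : τ.Orientation) {e : D}
    (he : ¬ τ.SameVertex e (τ.ι e)) : ∃ g : D → ZMod 2, ∀ a b s,
      collapseRel (fun x => x ≠ e ∧ x ≠ τ.ι e) (τ.turnRel ω.bit) a b s ↔
      collapseRel (fun x => x ≠ e ∧ x ≠ τ.ι e) ((τ.flip e).turnRel (ω.flip e).bit) a b
        (s + g a + g b) := by
  refine ⟨fun x => if τ.ι x = τ.σ (ω.head e) then 1 else 0, fun a b s => ?_⟩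
  have h0 := ω.bit_head e
  have h1 := ω.bit_flip e
  obtain h | h : ω.head e = e ∨ ω.head e = τ.ι e := by
    unfold Orientation.head
    split_ifs <;> simp
  · rw [h] at h0 h1 ⊢
    exact collapseRel_flip rfl he ω.bit_ι h0 h1 a b s
  · rw [h] at h0 h1 ⊢
    have := collapseRel_flip (τ.ι_ι e) (fun h => he h.symm) ω.bit_ι h0 h1 a b s
    rw [flip_ι_eq he] at this
    simpa only [and_comm] using this

/-- A closed path, as a closed walk on the graph with the edge collapsed. -/
theorem ClosedPath.exists_collapsed_walk (γ : τ.ClosedPath) (ω : τ.Orientation) {e : D}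
    (he : ¬ τ.SameVertex e (τ.ι e)) : ∃ a l,
      (γ.edges.filter fun x => x ≠ e ∧ x ≠ τ.ι e) ~r l ∧
      Walk (collapseRel (fun x => x ≠ e ∧ x ≠ τ.ι e) (τ.turnRel ω.bit)) a l a
        ((γ.numLeft + γ.numSame ω : ℕ) : ZMod 2) := by
  have hR := turnRel_ne (o := ω.bit) he
  have hp : ∃ x, x ≠ e ∧ x ≠ τ.ι e :=
    ⟨τ.σ e, τ.σ_ne e, fun h => he (Or.inr (Or.inl h.symm))⟩
  obtain ⟨a, l, ha, hl, h⟩ := (γ.walk ω).exists_rotation hR hp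
  exact ⟨a, _, hl.filter _, h.collapse hR ha ha⟩

/-- A closed walk on the graph with the edge collapsed comes from a closed path. -/
theorem exists_closedPath_of_collapsed_walk {o : D → ZMod 2} {e f a : D} {l : List D} {s : ZMod 2}
    (h : Walk (collapseRel (fun x => x ≠ e ∧ x ≠ f) (τ.turnRel o)) a l a s) :
    ∃ γ : τ.ClosedPath, (γ.edges.filter fun x => x ≠ e ∧ x ≠ f) = l := by
  obtain ⟨m, hm, h⟩ := h.exists_of_collapse
  obtain ⟨γ, rfl⟩ := exists_closedPath_of_walk h
  exact ⟨γ, hm⟩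

/-- On the collapsed graph the steps of a fatgraph and of its flip are the same, so closed paths can
be carried over. The orientation plays no role; it only provides weights. -/
theorem exists_flipHomotopic {e : D} (he : ¬ τ.SameVertex e (τ.ι e)) (ω : τ.Orientation)
    (γ : τ.ClosedPath) : ∃ γ' : (τ.flip e).ClosedPath, FlipHomotopic e γ γ' := by
  obtain ⟨g, hg⟩ := ω.exists_gauge_flip he
  obtain ⟨a, l, hl, h⟩ := γ.exists_collapsed_walk ω he
  obtain ⟨γ', rfl⟩ := exists_closedPath_of_collapsed_walk
    (h.gauge g fun a b s hs => (hg a b s).1 hs)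
  exact ⟨γ', hl⟩

/-- The converse of `exists_flipHomotopic`: every closed path on the flip comes from one on the
fatgraph. -/
theorem exists_flipHomotopic' {e : D} (he : ¬ τ.SameVertex e (τ.ι e)) (ω : τ.Orientation)
    (γ' : (τ.flip e).ClosedPath) : ∃ γ : τ.ClosedPath, FlipHomotopic e γ γ' := by
  obtain ⟨g, hg⟩ := ω.exists_gauge_flip he
  obtain ⟨a, l, hl, h⟩ := γ'.exists_collapsed_walk (ω.flip e) (flip_not_sameVertex rfl he)
  obtain ⟨γ, rfl⟩ := exists_closedPath_of_collapsed_walk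
    (h.gauge (R' := collapseRel (fun x => x ≠ e ∧ x ≠ τ.ι e) (τ.turnRel ω.bit)) g
      fun a b s hs => (hg a b _).2 (by
        have h1 := CharTwo.add_self_eq_zero (g a)
        have h2 := CharTwo.add_self_eq_zero (g b)
        have h3 : s + g a + g b + g a + g b = s := by linear_combination h1 + h2
        rwa [h3]))
  exact ⟨γ, hl.symm⟩

/-- The ends of a step on the collapsed graph determine whether and how it passes the edge. -/
theorem collapseRel_turnRel_unique {o : D → ZMod 2} {e : D} (he : ¬ τ.SameVertex e (τ.ι e))
    (a b : D) (s t : ZMod 2)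
    (hs : collapseRel (fun x => x ≠ e ∧ x ≠ τ.ι e) (τ.turnRel o) a b s)
    (ht : collapseRel (fun x => x ≠ e ∧ x ≠ τ.ι e) (τ.turnRel o) a b t) : s = t := by
  have aux : ∀ m, ¬ (m ≠ e ∧ m ≠ τ.ι e) → ¬ τ.SameVertex m (τ.ι m) := by
    intro m hm h
    obtain rfl | rfl : m = e ∨ m = τ.ι e := by
      by_contra h'
      exact hm (not_or.1 h')
    · exact he h
    · rw [τ.ι_ι] at h
      exact he h.symm
  have direct : ∀ m s s₁ s₂, ¬ (m ≠ e ∧ m ≠ τ.ι e) → τ.turnRel o a b s → τ.turnRel o a m s₁ →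
      ¬ τ.turnRel o m b s₂ := fun m s s₁ s₂ hm h h₁ h₂ =>
    aux m hm ((turnRel_sameVertex h₁).symm.trans
      ((turnRel_sameVertex h).trans (turnRel_sameVertex h₂).symm))
  obtain ⟨-, -, hs | ⟨m, s₁, s₂, hm, h₁, h₂, rfl⟩⟩ := hs <;>
    obtain ⟨-, -, ht | ⟨m', t₁, t₂, hm', h₁', h₂', rfl⟩⟩ := ht
  · exact turnRel_unique _ _ _ _ hs ht
  · exact absurd h₂' (direct m' _ _ _ hm' hs h₁')
  · exact absurd h₂ (direct m _ _ _ hm ht h₁)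
  · have h := (turnRel_sameVertex h₁).symm.trans (turnRel_sameVertex h₁')
    obtain rfl : m = m' := by
      have h4 := τ.ι_ι e
      have := aux m hm
      grind
    rw [turnRel_unique _ _ _ _ h₁ h₁', turnRel_unique _ _ _ _ h₂ h₂']

/-- Homotopic closed paths on a fatgraph and on its flip have the same weight. -/
theorem FlipHomotopic.weight_eq {e : D} (he : ¬ τ.SameVertex e (τ.ι e)) (ω : τ.Orientation)
    {γ : τ.ClosedPath} {γ' : (τ.flip e).ClosedPath} (h : FlipHomotopic e γ γ') :
    ((γ'.numLeft + γ'.numSame (ω.flip e) : ℕ) : ZMod 2) =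
      ((γ.numLeft + γ.numSame ω : ℕ) : ZMod 2) := by
  obtain ⟨g, hg⟩ := ω.exists_gauge_flip he
  obtain ⟨a, l, hl, w⟩ := γ.exists_collapsed_walk ω he
  obtain ⟨a', l', hl', w'⟩ := γ'.exists_collapsed_walk (ω.flip e) (flip_not_sameVertex rfl he)
  have w₁ := w.gauge g fun a b s hs => (hg a b s).1 hs
  rw [add_assoc, CharTwo.add_self_eq_zero, add_zero] at w₁
  have hll : l' ~r l := hl'.symm.trans (h.symm.trans hl)
  exact w'.closed_weight_unique
    (collapseRel_turnRel_unique (τ := τ.flip e) (flip_not_sameVertex rfl he)) w₁ hll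

end Flip

/-! ### Classes of orientations are determined by closed paths -/

variable (τ) in
/-- A path that has passed along the half-edge `y`, away from its vertex, is at the vertex of
`τ.ι y` and can leave it along `z`, possibly backtracking. The weight is `δ z`. -/
def vertexRel (δ : D → ZMod 2) (y z : D) (s : ZMod 2) : Prop := τ.SameVertex (τ.ι y) z ∧ s = δ z

section VertexWalks

variable {δ : D → ZMod 2} {a b c : D} {l : List D} {s t : ZMod 2}

theorem vertexWalk_weight (h : Walk (τ.vertexRel δ) a l b s) : s = (l.map δ).sum := by
  induction h with
  | nil => rfl
  | cons hs _ ih => rw [List.map_cons, List.sum_cons, ← ih, hs.2]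

theorem vertexWalk_congr_start (h : Walk (τ.vertexRel δ) a l b s)
    (hc : τ.SameVertex (τ.ι c) (τ.ι a)) (hl : l ≠ []) : Walk (τ.vertexRel δ) c l b s := by
  cases h with
  | nil => exact absurd rfl hl
  | cons hs h => exact .cons ⟨hc.trans hs.1, hs.2⟩ h

/-- A walk either is a path without backtracking or backtracks somewhere. -/
theorem vertexWalk_backtrack (h : Walk (τ.vertexRel δ) a l b s) :
    (∃ t, Walk (τ.turnRel δ) a l b t) ∨ ∃ y l₁ l₂ s₁ s₂, l = l₁ ++ τ.ι y :: l₂ ∧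
      Walk (τ.vertexRel δ) a l₁ y s₁ ∧ Walk (τ.vertexRel δ) (τ.ι y) l₂ b s₂ ∧
      s = s₁ + (δ (τ.ι y) + s₂) := by
  induction h with
  | nil a => exact Or.inl ⟨0, .nil a⟩
  | @cons x y z l s t hs h ih =>
    by_cases hxy : y = τ.ι x
    · subst hxy
      exact Or.inr ⟨x, [], l, 0, t, rfl, .nil x, h, by rw [hs.2, zero_add]⟩
    obtain ⟨r, hr⟩ | ⟨y', l₁, l₂, s₁, s₂, rfl, h₁, h₂, rfl⟩ := ih
    · obtain ⟨h' | h' | h', -⟩ := hs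
      · exact absurd h' hxy
      · exact Or.inl ⟨_, .cons (Or.inr ⟨h', rfl⟩) hr⟩
      · exact Or.inl ⟨_, .cons (Or.inl ⟨h', rfl⟩) hr⟩
    · exact Or.inr ⟨y', y :: l₁, l₂, s + s₁, s₂, rfl, .cons hs h₁, h₂, (add_assoc _ _ _).symm⟩

theorem exists_of_not_pairwise {α : Type*} {r : α → α → Prop} {l : List α}
    (h : ¬ l.Pairwise fun x y => ¬ r x y) :
    ∃ l₁ x l₂ y l₃, l = l₁ ++ x :: (l₂ ++ y :: l₃) ∧ r x y := by
  induction l with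
  | nil => exact absurd .nil h
  | cons x l ih =>
    rw [List.pairwise_cons, not_and_or] at h
    by_cases hx : ∀ y ∈ l, ¬ r x y
    · obtain ⟨l₁, x', l₂, y, l₃, rfl, hr⟩ := ih (h.resolve_left (not_not.2 hx))
      exact ⟨x :: l₁, x', l₂, y, l₃, rfl, hr⟩
    · push Not at hx
      obtain ⟨y, hy, hr⟩ := hx
      obtain ⟨l₂, l₃, rfl⟩ := List.append_of_mem hy
      exact ⟨[], x, l₂, y, l₃, rfl, hr⟩

/-- If `δ` sums to zero along the embedded closed paths, then it does along all closed walks. A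
shortest counterexample would meet each vertex at most once, since otherwise it could be split, and
would not backtrack, since otherwise it could be shortened. -/
theorem vertexWalk_closed_weight (hδ : ∀ x, δ (τ.ι x) = δ x)
    (hγ : ∀ γ : τ.ClosedPath, γ.IsEmbedded → (γ.edges.map δ).sum = 0)
    (h : Walk (τ.vertexRel δ) a l b s) (hab : τ.SameVertex (τ.ι b) (τ.ι a)) : s = 0 := by
  induction hn : l.length using Nat.strong_induction_on generalizing a b l s with
  | _ n ih =>
  subst hn
  by_cases hl : l = []
  · subst hl
    cases h
    rfl
  replace h := vertexWalk_congr_start h hab hl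
  clear hab hl a
  by_cases hp : l.Pairwise fun x y => ¬ τ.SameVertex x y
  swap
  · -- The walk leaves the vertex of `x` a second time along `y`; split it there.
    obtain ⟨l₁, x, l₂, y, l₃, rfl, hxy⟩ := exists_of_not_pairwise hp
    obtain ⟨c, s₁, s₂, h₁, h₂, rfl⟩ := h.exists_of_append
    obtain _ | @⟨_, _, _, _, s₂, s₃, hx, h₂⟩ := h₂
    obtain ⟨d, s₃, s₄, k₂, h₃, rfl⟩ := h₂.exists_of_append
    obtain _ | @⟨_, _, _, _, s₄, s₅, hy, h₃⟩ := h₃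
    replace h₁ : Walk (τ.vertexRel δ) b (l₁ ++ y :: l₃) b _ :=
      h₁.append (.cons ⟨hx.1.trans hxy, hy.2⟩ h₃)
    replace k₂ : Walk (τ.vertexRel δ) d (x :: l₂) d _ :=
      .cons ⟨hy.1.trans hxy.symm, hx.2⟩ k₂
    have e₁ := ih _ (by simp) h₁ (Or.inl rfl) rfl
    have e₂ := ih _ (by simp; omega) k₂ (Or.inl rfl) rfl
    linear_combination e₁ + e₂
  obtain ⟨t, ht⟩ | ⟨y, l₁, l₂, s₁, s₂, rfl, h₁, h₂, rfl⟩ := vertexWalk_backtrack h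
  · -- The walk is an embedded closed path.
    obtain ⟨γ, rfl⟩ := exists_closedPath_of_walk ht
    rw [vertexWalk_weight h]
    exact hγ γ hp
  · -- The walk passes along `y` and at once back along `τ.ι y`. What is left without these two
    -- passages is closed as well, and together they have weight `δ y + δ y = 0`.
    have k := h₂.append h₁
    obtain e | ⟨m, z, e⟩ := List.eq_nil_or_concat' (l₂ ++ l₁)
    · have := k.eq_getLastD
      rw [e] at this
      exact absurd this.symm (τ.ι_ne y)
    · have hlen := congrArg List.length e
      rw [e] at k
      obtain ⟨c, s₃, s₄, w, k', e'⟩ := k.exists_of_append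
      obtain _ | @⟨_, _, _, _, s₄, s₅, hz, k'⟩ := k'
      cases k'
      have e₁ := ih _ (by simp at hlen ⊢; omega) w (by rw [τ.ι_ι]; exact hz.1) rfl
      have h2 := CharTwo.add_self_eq_zero (δ y)
      have hz2 := hz.2
      rw [hδ]
      linear_combination e' + e₁ + hz2 + h2

variable (τ δ) in
/-- There is a walk of weight `s` from the vertex of `x` to the vertex of `y`. -/
def Joined (x y : D) (s : ZMod 2) : Prop :=
  ∃ b l, Walk (τ.vertexRel δ) (τ.ι x) l b s ∧ τ.SameVertex (τ.ι b) y

theorem Joined.refl (x : D) : τ.Joined δ x x 0 :=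
  ⟨τ.ι x, [], .nil _, Or.inl (τ.ι_ι x).symm⟩

theorem Joined.σ {x y : D} (h : τ.Joined δ x y s) : τ.Joined δ x (τ.σ y) s := by
  obtain ⟨b, l, h, hb⟩ := h
  exact ⟨b, l, h, sameVertex_σ.2 hb⟩

theorem Joined.ι {x y : D} (h : τ.Joined δ x y s) : τ.Joined δ x (τ.ι y) (s + δ y) := by
  obtain ⟨b, l, h, hb⟩ := h
  refine ⟨y, l ++ [y], ?_, Or.inl rfl⟩
  have := h.append (.cons ⟨hb, rfl⟩ (.nil y))
  rwa [add_zero] at this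

theorem Joined.trans {x y z : D} (h : τ.Joined δ x y s) (h' : τ.Joined δ y z t) :
    τ.Joined δ x z (s + t) := by
  obtain ⟨b, l, h, hb⟩ := h
  obtain ⟨c, m, h', hc⟩ := h'
  by_cases hm : m = []
  · subst hm
    cases h'
    rw [τ.ι_ι] at hc
    exact ⟨b, l, by rwa [add_zero], hb.trans hc⟩
  · exact ⟨c, l ++ m, h.append (vertexWalk_congr_start h' (by rwa [τ.ι_ι]) hm), hc⟩

/-- A function of the edges that sums to zero along the embedded closed paths is a coboundary. -/
theorem exists_potential (hD : Nonempty D) (hJ : ∀ x y : D, ∃ s, τ.Joined δ x y s)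
    (hδ : ∀ x, δ (τ.ι x) = δ x)
    (hγ : ∀ γ : τ.ClosedPath, γ.IsEmbedded → (γ.edges.map δ).sum = 0) :
    ∃ g : D → ZMod 2, (∀ x, g (τ.σ x) = g x) ∧ ∀ x, δ x = g x + g (τ.ι x) := by
  obtain ⟨x₀⟩ := hD
  -- `g x` is the weight of any walk from `x₀` to the vertex of `x`.
  have closed : ∀ {x s}, τ.Joined δ x x s → s = 0 := by
    rintro x s ⟨b, l, h, hb⟩
    exact vertexWalk_closed_weight hδ hγ h (by rwa [τ.ι_ι])
  have unique : ∀ {y s t}, τ.Joined δ x₀ y s → τ.Joined δ x₀ y t → s = t := by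
    intro y s t hs ht
    obtain ⟨r, hr⟩ := hJ y x₀
    exact add_right_cancel ((closed (hs.trans hr)).trans (closed (ht.trans hr)).symm)
  choose g hg using hJ x₀
  refine ⟨g, fun x => unique (hg _) (hg x).σ, fun x => ?_⟩
  rw [unique (hg (τ.ι x)) (hg x).ι, ← add_assoc, CharTwo.add_self_eq_zero, zero_add]

end VertexWalks

theorem Orientation.ext_bit {ω ω' : τ.Orientation} (h : ∀ x, ω.bit x = ω'.bit x) : ω = ω' := by
  obtain ⟨o, ho⟩ := ω
  obtain ⟨o', ho'⟩ := ω'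
  congr
  funext x
  have := h x
  unfold bit at this
  grind

theorem ClosedPath.numSame_eq_sum (γ : τ.ClosedPath) (ω : τ.Orientation) :
    ((γ.numSame ω : ℕ) : ZMod 2) = (γ.edges.map ω.bit).sum := by
  unfold numSame
  induction γ.edges with
  | nil => rfl
  | cons x l ih =>
    rw [List.countP_cons, List.map_cons, List.sum_cons, ← ih]
    unfold Orientation.bit
    push_cast
    ring

variable [DecidableEq D]

/-- Orientations that differ by a coboundary are equivalent: reflect at the vertices where the
function of the vertices does not vanish. -/
theorem Orientation.equivalent_of_coboundary [Finite D] {ω ω' : τ.Orientation} {g : D → ZMod 2}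
    (hg : ∀ x, g (τ.σ x) = g x) (h : ∀ x, ω'.bit x = ω.bit x + g x + g (τ.ι x)) :
    ω.Equivalent ω' := by
  induction hn : {x | g x ≠ 0}.ncard using Nat.strong_induction_on generalizing ω g with
  | _ n ih =>
  subst hn
  by_cases h0 : ∀ x, g x = 0
  · rw [show ω' = ω from ext_bit fun x => by rw [h, h0, h0, add_zero, add_zero]]
    exact .refl
  push Not at h0
  obtain ⟨v, hv⟩ := h0
  have one : ∀ z : ZMod 2, z ≠ 0 → z = 1 := by decide
  have hgv : ∀ x, τ.SameVertex v x → g x = 1 := by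
    rintro x (rfl | rfl | rfl)
    · exact one _ hv
    · rw [hg]; exact one _ hv
    · rw [hg, hg]; exact one _ hv
  have h11 : (1 : ZMod 2) + 1 = 0 := by decide
  refine Relation.ReflTransGen.head ⟨v, rfl⟩
    (ih _ ?_ (ω := ω.reflect v) (g := fun x => g x + τ.vertexBit v x) ?_ ?_ rfl)
  · refine Set.ncard_lt_ncard (Set.ssubset_iff_exists.2 ⟨fun x hx => ?_, v, hv, ?_⟩)
      (Set.toFinite _)
    · by_cases hx' : τ.SameVertex v x
      · exact absurd (by simp only [vertexBit, if_pos hx', hgv x hx', h11]) hx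
      · simpa [vertexBit, if_neg hx'] using hx
    · have : τ.SameVertex v v := Or.inl rfl
      simp only [Set.mem_ofPred_eq, vertexBit, if_pos this, hgv v this, h11, ne_eq,
        not_true_eq_false, not_false_eq_true]
  · intro x
    rw [hg, vertexBit_σ]
  · intro x
    have h1 := CharTwo.add_self_eq_zero (τ.vertexBit v x)
    have h2 := CharTwo.add_self_eq_zero (τ.vertexBit v (τ.ι x))
    rw [ω.bit_reflect, h]
    linear_combination -h1 - h2

/-- On a connected fatgraph the weights of the embedded closed paths determine the class of an
orientation. -/
theorem Orientation.equivalent_of_embedded [Finite D] {ω ω' : τ.Orientation} (hD : Nonempty D)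
    (hJ : ∀ (δ : D → ZMod 2) (x y : D), ∃ s, τ.Joined δ x y s)
    (h : ∀ γ : τ.ClosedPath, γ.IsEmbedded → ((γ.numLeft + γ.numSame ω' : ℕ) : ZMod 2) =
      ((γ.numLeft + γ.numSame ω : ℕ) : ZMod 2)) : ω.Equivalent ω' := by
  obtain ⟨g, hg, hg'⟩ := exists_potential (τ := τ) (δ := fun x => ω.bit x + ω'.bit x) hD (hJ _)
    (fun x => by
      have : (1 : ZMod 2) + 1 = 0 := by decide
      rw [ω.bit_ι, ω'.bit_ι]
      linear_combination this)
    (fun γ hγ => by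
      have := h γ hγ
      push_cast at this
      rw [List.sum_map_add, ← γ.numSame_eq_sum, ← γ.numSame_eq_sum, add_left_cancel this,
        CharTwo.add_self_eq_zero])
  refine equivalent_of_coboundary hg fun x => ?_
  rw [add_assoc, ← hg', ← add_assoc, CharTwo.add_self_eq_zero, zero_add]

/-- The flip of a connected fatgraph is connected. -/
theorem Connected.joined_flip (hτ : τ.Connected) {e : D} (he : ¬ τ.SameVertex e (τ.ι e))
    (δ : D → ZMod 2) (x y : D) : ∃ s, (τ.flip e).Joined δ x y s := by
  obtain ⟨tA, tB, tC, tD, tE, tF, t⟩ := flip_table rfl he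
  induction hτ.2 x y with
  | refl => exact ⟨0, Joined.refl x⟩
  | @tail y z _ h ih =>
    obtain ⟨s, hs⟩ := ih
    have hs' := hs.ι
    rw [show (τ.flip e).ι = τ.ι from rfl] at hs'
    obtain rfl | rfl := h
    · by_cases hy : τ.SameVertex e y
      · obtain rfl | rfl | rfl := hy
        · have := hs'.σ.σ
          rw [tD, tE] at this
          exact ⟨_, this⟩
        · have := hs.σ.ι.σ
          rw [tF, show (τ.flip e).ι = τ.ι from rfl, τ.ι_ι, tA] at this
          exact ⟨_, this⟩
        · have := hs.σ.σ
          rw [tB, tC] at this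
          rw [τ.σ_cube]
          exact ⟨_, this⟩
      by_cases hy' : τ.SameVertex (τ.ι e) y
      · obtain rfl | rfl | rfl := hy'
        · rw [τ.ι_ι] at hs'
          have := hs'.σ.σ
          rw [tA, tB] at this
          exact ⟨_, this⟩
        · have := hs.σ.ι.σ
          rw [tC, show (τ.flip e).ι = τ.ι from rfl, tD] at this
          exact ⟨_, this⟩
        · have := hs.σ.σ
          rw [tE, tF] at this
          rw [τ.σ_cube]
          exact ⟨_, this⟩
      · rw [← t y hy hy']
        exact ⟨_, hs.σ⟩
    · exact ⟨_, hs'⟩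

/-- Only one class of orientations of the flip has the weights of `ω` on the embedded paths. -/
theorem Orientation.flip_equivalent_of_weight_eq [Finite D] (hτ : τ.Connected)
    (ω : τ.Orientation) {e : D} (he : ¬ τ.SameVertex e (τ.ι e)) (ω' : (τ.flip e).Orientation)
    (h : ∀ (γ : τ.ClosedPath) (γ' : (τ.flip e).ClosedPath), γ'.IsEmbedded →
      FlipHomotopic e γ γ' → ((γ'.numLeft + γ'.numSame ω' : ℕ) : ZMod 2) =
        ((γ.numLeft + γ.numSame ω : ℕ) : ZMod 2)) :
    (ω.flip e).Equivalent ω' := by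
  refine equivalent_of_embedded hτ.1 (hτ.joined_flip he) fun γ' hγ' => ?_
  obtain ⟨γ, hγ⟩ := exists_flipHomotopic' he ω γ'
  rw [h γ γ' hγ' hγ, hγ.weight_eq he ω]

end Fatgraph

end SuperTeich

/-! ### The values of the quadratic form and the flip -/

theorem mainTheorem7 {D : Type*} [Finite D] [DecidableEq D]
    {V : Type*} [AddCommGroup V] [Module ℝ V]
    (τ : SuperTeich.Fatgraph D) (hτ : τ.Connected)
    (C : τ.Coordinates V) (ω ωι : τ.Orientation) :
    -- the values of the quadratic form
    (∀ γ : τ.ClosedPath,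
      C.quadForm ω ωι γ = (-1) ^ γ.numLeft * (-1) ^ γ.numSame ω ∧
      C.quadForm ω ωι γ = (-1) ^ γ.numRight * (-1) ^ γ.numOpposite ω) ∧
    -- they depend only on the class of the orientation
    (∀ ω₁ : τ.Orientation, ω.Equivalent ω₁ →
      ∀ γ : τ.ClosedPath, C.quadForm ω₁ ωι γ = C.quadForm ω ωι γ) ∧
    -- the evolution of the spin structure under the flip along an edge with different ends
    (∀ e : D, ¬ τ.SameVertex e (τ.ι e) →
      (∀ ω₁ : τ.Orientation, ω.Equivalent ω₁ → (ω.flip e).Equivalent (ω₁.flip e)) ∧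
      (∀ γ : τ.ClosedPath, ∃ γ' : (τ.flip e).ClosedPath, SuperTeich.Fatgraph.FlipHomotopic e γ γ') ∧
      (∀ γ' : (τ.flip e).ClosedPath, ∃ γ : τ.ClosedPath, SuperTeich.Fatgraph.FlipHomotopic e γ γ') ∧
      ∀ (C' : (τ.flip e).Coordinates V) (ωι' : (τ.flip e).Orientation),
        (∀ (γ : τ.ClosedPath) (γ' : (τ.flip e).ClosedPath),
          SuperTeich.Fatgraph.FlipHomotopic e γ γ' →
          C'.quadForm (ω.flip e) ωι' γ' = C.quadForm ω ωι γ) ∧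
        (∀ ω' : (τ.flip e).Orientation,
          (∀ (γ : τ.ClosedPath) (γ' : (τ.flip e).ClosedPath), γ'.IsEmbedded →
            SuperTeich.Fatgraph.FlipHomotopic e γ γ' →
            C'.quadForm ω' ωι' γ' = C.quadForm ω ωι γ) →
          (ω.flip e).Equivalent ω')) := by
  refine ⟨fun γ => ⟨?_, ?_⟩, fun ω₁ h γ => ?_, fun e he => ⟨fun ω₁ h => ?_, fun γ => ?_,
    fun γ' => ?_, fun C' ωι' => ⟨fun γ γ' h => ?_, fun ω' h => ?_⟩⟩⟩
  · rw [C.quadForm_eq, pow_add]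
  · rw [C.quadForm_eq_right, pow_add]
  · exact (SuperTeich.Fatgraph.quadForm_eq_quadForm_iff ..).2 (γ.weight_eq_of_equivalent h)
  · -- The flip of `ω₁` has the values of `ω₁`, which are those of `ω`.
    refine ω.flip_equivalent_of_weight_eq hτ he _ fun γ γ' _ hγ => ?_
    rw [hγ.weight_eq he ω₁, γ.weight_eq_of_equivalent h]
  · exact SuperTeich.Fatgraph.exists_flipHomotopic he ω γ
  · exact SuperTeich.Fatgraph.exists_flipHomotopic' he ω γ'
  · exact (SuperTeich.Fatgraph.quadForm_eq_quadForm_iff ..).2 (h.weight_eq he ω)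
  · exact ω.flip_equivalent_of_weight_eq hτ he ω' fun γ γ' hγ' hγ =>
      (SuperTeich.Fatgraph.quadForm_eq_quadForm_iff ..).1 (h γ γ' hγ' hγ)
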